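/- Let $(X,d,\mu)$ be a complete metric space with at least two points, equipped with a doubling Borel regular outer measure $\mu$ (balls have positive finite measure and $\mu(B(x,2r))\le C_d\,\mu(B(x,r))$), and supporting a $(1,1)$-Poincaré inequality with respect to upper gradients. Definitions. For open $U\subset X$ let $\|Du\|(U)=\inf\{\liminf_i\int_U g_i\,d\mu\}$, where the infimum is over all $u_i\in \mathrm{Lip}_{\mathrm{loc}}(U)$ with $u_i\to u$ in $L^1_{\mathrm{loc}}(U)$ and all upper gradients $g_i$ of $u_i$ in $U$; for arbitrary $A\subset X$ let $\|Du\|(A)=\inf\{\|Du\|(U):A\subset U,\ U \text{ open}\}$. Write $u\in \mathrm{BV}(U)$ if $u\in L^1(U)$ and $\|Du\|(U)<\infty$, and let $P(E,\cdot)=\|D\chi_E\|(\cdot)$, a Borel measure if $P(E,X)<\infty$. Let $\mathcal H=\lim_{R\to0}\mathcal H_R$ be the codimension one Hausdorff measure, where $\mathcal H_R(A)$ is the infimum of $\sum_i \mu(B(x_i,r_i))/r_i$ over at most countable covers of $A$ by balls with radii $r_i\le R$. Let $\partial^*E$ be the set of points at which both $E$ and $X\setminus E$ have positive upper density. A number $Tu(x)$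 is the trace of $u$ at $x\in\partial\Omega$ if $$\lim_{r\to0}\frac1{\mu(B(x,r)\cap\Omega)}\int_{B(x,r)\cap\Omega}|u-Tu(x)|\,d\mu=0 .$$ Let $\Omega\subset X$ be a nonempty bounded open set with $P(\Omega,X)<\infty$ such that every $u\in\mathrm{BV}(\Omega)$ has a trace at $\mathcal H$-a.e. $x\in\partial^*\Omega$. Let $f\in L^1(\partial^*\Omega,P(\Omega,\cdot))$ with $\int_{\partial^*\Omega}f\,dP(\Omega,\cdot)=0$, and set $$I(u)=\|Du\|(\Omega)+\int_{\partial^*\Omega}Tu\,f\,dP(\Omega,\cdot).$$ A function $u\in \mathrm{BV}(\Omega)$ with $-1\le u\le1$ (a.e. in $\Omega$) is called a solution of the restricted Neumann problem with boundary data $f$ if $I(u)\le I(v)$ for all $v\in \mathrm{BV}(\Omega)$ with $-1\le v\le 1$ (a.e. in $\Omega$). Proposition. Let $u\in\mathrm{BV}(\Omega)$ with $-1\le u\le1$ a.e. in $\Omega$. Then there are disjoint $\mu$-measurable sets $E_1,E_2\subset\Omega$ with $\chi_{E_1}-\chi_{E_2}\in\mathrm{BV}(\Omega)$ and $$I(\chi_{E_1}-\chi_{E_2})\le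 I(u).$$ Furthermore, if $u$ is a solution of the restricted Neumann problem with boundary data $f$, then there is a Lebesgue null set $N\subset\mathbb R$ such that for all $t_1,t_2\in(0,1)\setminus N$ the sets $E_1=\{x\in\Omega:u(x)>t_1\}$ and $E_2=\{x\in\Omega:u(x)<-t_2\}$ give a solution $\chi_{E_1}-\chi_{E_2}$ of the same problem. -/

import Mathlib

open MeasureTheory Filter Topology Set
open scoped ENNReal NNReal

namespace MetricBV

/-- `μ` is doubling: balls have positive finite measure, and doubling the radius multiplies the
measure by at most a fixed constant. -/
def IsDoubling {X : Type*} [MetricSpace X] [MeasurableSpace X] (μ : Measure X) : Prop :=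
  ∃ C : ℝ≥0, 1 ≤ C ∧ ∀ (x : X) (r : ℝ), 0 < r →
    0 < μ (Metric.ball x (2 * r)) ∧
    μ (Metric.ball x (2 * r)) ≤ C * μ (Metric.ball x r) ∧
    μ (Metric.ball x r) < ∞

/-- `g` is an upper gradient of `u` in `Ω`. The curves in `Ω` are the maps `γ : [0, l] → Ω`,
`0 < l`, parametrized by arc length: the length of `γ` between `s` and `t` is `t - s`. These are
exactly the nonconstant rectifiable curves, parametrized by arc length. -/
def IsUpperGradient {X : Type*} [MetricSpace X] [MeasurableSpace X]
    (g : X → ℝ≥0∞) (u : X → ℝ) (Ω : Set X) : Prop :=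
  Measurable g ∧ ∀ (l : ℝ) (γ : ℝ → X), 0 < l → HasUnitSpeedOn γ (Icc 0 l) →
    (∀ s ∈ Icc 0 l, γ s ∈ Ω) →
    ENNReal.ofReal |u (γ 0) - u (γ l)| ≤ ∫⁻ s in Icc 0 l, g (γ s)

/-- The (1,1)-Poincaré inequality. -/
def SupportsPoincare {X : Type*} [MetricSpace X] [MeasurableSpace X] (μ : Measure X) : Prop :=
  ∃ C lam : ℝ, 0 < C ∧ 1 ≤ lam ∧ ∀ (u : X → ℝ) (g : X → ℝ≥0∞),
    LocallyIntegrable u μ → IsUpperGradient g u univ → ∀ (x : X) (r : ℝ), 0 < r →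
      ⨍⁻ y in Metric.ball x r, ENNReal.ofReal |u y - ⨍ z in Metric.ball x r, u z ∂μ| ∂μ ≤
        ENNReal.ofReal (C * r) * ⨍⁻ y in Metric.ball x (lam * r), g y ∂μ

/-- `U ⋐ Ω`, with `U` open: the closure of `U` is a compact subset of `Ω`. -/
def CompactlyInside {X : Type*} [TopologicalSpace X] (U Ω : Set X) : Prop :=
  IsOpen U ∧ IsCompact (closure U) ∧ closure U ⊆ Ω

/-- `u ∈ Lip_loc(Ω)`. -/
def LipLoc {X : Type*} [MetricSpace X] (u : X → ℝ) (Ω : Set X) : Prop :=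
  ∀ U : Set X, CompactlyInside U Ω → ∃ K : ℝ≥0, LipschitzOnWith K u U

/-- `v i → u` in `L¹_loc(Ω)`. -/
def TendstoL1Loc {X : Type*} [MetricSpace X] [MeasurableSpace X] (μ : Measure X)
    (v : ℕ → X → ℝ) (u : X → ℝ) (Ω : Set X) : Prop :=
  ∀ U : Set X, CompactlyInside U Ω →
    Tendsto (fun i => ∫⁻ x in U, ENNReal.ofReal |v i x - u x| ∂μ) atTop (𝓝 0)

/-- The total variation `‖Du‖(Ω)` of `u` in an open set `Ω`, by relaxation. -/
noncomputable def totalVariation {X : Type*} [MetricSpace X] [MeasurableSpace X] (μ : Measure X)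
    (u : X → ℝ) (Ω : Set X) : ℝ≥0∞ :=
  ⨅ (v : ℕ → X → ℝ) (g : ℕ → X → ℝ≥0∞) (_ : ∀ i, LipLoc (v i) Ω)
    (_ : ∀ i, IsUpperGradient (g i) (v i) Ω) (_ : TendstoL1Loc μ v u Ω),
    liminf (fun i => ∫⁻ x in Ω, g i x ∂μ) atTop

/-- The variation `‖Du‖(A)` of `u` on an arbitrary set `A`. -/
noncomputable def variation {X : Type*} [MetricSpace X] [MeasurableSpace X] (μ : Measure X)
    (u : X → ℝ) (A : Set X) : ℝ≥0∞ :=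
  ⨅ (U : Set X) (_ : IsOpen U) (_ : A ⊆ U), totalVariation μ u U

/-- `u ∈ BV(Ω)`. Only the values of `u` on `Ω` matter. -/
def BV {X : Type*} [MetricSpace X] [MeasurableSpace X] (μ : Measure X)
    (u : X → ℝ) (Ω : Set X) : Prop :=
  IntegrableOn u Ω μ ∧ totalVariation μ u Ω < ∞

theorem totalVariation_empty {X : Type*} [MetricSpace X] [MeasurableSpace X] (μ : Measure X)
    (u : X → ℝ) : totalVariation μ u ∅ = 0 := by
  refine le_antisymm ?_ bot_le
  unfold totalVariation
  refine iInf_le_of_le (fun _ _ => 0) <| iInf_le_of_le (fun _ _ => 0) <|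
    iInf_le_of_le ?_ <| iInf_le_of_le ?_ <| iInf_le_of_le ?_ ?_
  · intro i U _
    exact ⟨0, fun x _ y _ => by simp⟩
  · intro i
    exact ⟨measurable_const, fun l γ hl _ h => absurd (h 0 ⟨le_rfl, hl.le⟩) (by simp)⟩
  · intro U hU
    have : U = ∅ := subset_empty_iff.1 (subset_closure.trans hU.2.2)
    simp [this]
  · simp

theorem liminf_add_le_aux (a b : ℕ → ℝ≥0∞) :
    liminf a atTop + liminf b atTop ≤ liminf (fun i => a i + b i) atTop := by
  simp only [liminf_eq_iSup_iInf_of_nat]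
  rw [ENNReal.iSup_add_iSup_of_monotone]
  · refine iSup_mono fun n => le_iInf fun i => le_iInf fun hi => ?_
    exact add_le_add (iInf₂_le i hi) (iInf₂_le i hi)
  · exact fun m n h => le_iInf₂ fun i hi => iInf₂_le i (h.trans hi)
  · exact fun m n h => le_iInf₂ fun i hi => iInf₂_le i (h.trans hi)

theorem totalVariation_add_le {X : Type*} [MetricSpace X] [MeasurableSpace X] [BorelSpace X]
    (μ : Measure X) (u : X → ℝ) {U V W : Set X} (hV : IsOpen V) (hUW : U ⊆ W) (hVW : V ⊆ W)
    (hUV : Disjoint U V) :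
    totalVariation μ u U + totalVariation μ u V ≤ totalVariation μ u W := by
  conv_rhs => unfold totalVariation
  refine le_iInf fun v => le_iInf fun g => le_iInf fun h1 => le_iInf fun h2 => le_iInf fun h3 => ?_
  have key : ∀ S : Set X, S ⊆ W →
      totalVariation μ u S ≤ liminf (fun i => ∫⁻ x in S, g i x ∂μ) atTop := by
    intro S hS
    refine iInf_le_of_le v <| iInf_le_of_le g <|
      iInf_le_of_le ?_ <| iInf_le_of_le ?_ <| iInf_le_of_le ?_ le_rfl
    · exact fun i B hB => h1 i B ⟨hB.1, hB.2.1, hB.2.2.trans hS⟩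
    · exact fun i => ⟨(h2 i).1, fun l γ hl hγ hin =>
        (h2 i).2 l γ hl hγ fun s hs => hS (hin s hs)⟩
    · exact fun B hB => h3 B ⟨hB.1, hB.2.1, hB.2.2.trans hS⟩
  refine (add_le_add (key U hUW) (key V hVW)).trans ?_
  refine (liminf_add_le_aux _ _).trans (liminf_le_liminf (Eventually.of_forall fun i => ?_))
  show (∫⁻ x in U, g i x ∂μ) + (∫⁻ x in V, g i x ∂μ) ≤ _
  rw [← lintegral_union hV.measurableSet hUV]
  exact lintegral_mono_set (union_subset hUW hVW)

theorem variation_empty {X : Type*} [MetricSpace X] [MeasurableSpace X] (μ : Measure X)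
    (u : X → ℝ) : variation μ u ∅ = 0 := by
  refine le_antisymm ?_ bot_le
  exact iInf_le_of_le ∅ <| iInf_le_of_le isOpen_empty <| iInf_le_of_le subset_rfl
    (totalVariation_empty μ u).le

/-- The largest outer measure that is at most `‖Du‖(A)` on every set `A`. If `u` has finite
variation, then `A ↦ ‖Du‖(A)` is itself an outer measure, so that the two agree. -/
noncomputable def variationOuterMeasure {X : Type*} [MetricSpace X] [MeasurableSpace X]
    (μ : Measure X) (u : X → ℝ) : OuterMeasure X :=
  OuterMeasure.ofFunction (variation μ u) (variation_empty μ u)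

theorem variationOuterMeasure_isMetric {X : Type*} [MetricSpace X] [MeasurableSpace X]
    [BorelSpace X] (μ : Measure X) (u : X → ℝ) :
    (variationOuterMeasure μ u).IsMetric := by
  intro s t hst
  refine le_antisymm (measure_union_le s t) ?_
  obtain ⟨S, T, hS, hT, hsS, htT, hd⟩ :
      ∃ S T : Set X, IsOpen S ∧ IsOpen T ∧ s ⊆ S ∧ t ⊆ T ∧ Disjoint S T := by
    obtain ⟨r, hr, h⟩ := hst
    have hr2 : 0 < r / 2 := (ENNReal.half_pos hr)
    refine ⟨⋃ x ∈ s, Metric.eball x (r / 2), ⋃ x ∈ t, Metric.eball x (r / 2),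
      isOpen_biUnion fun _ _ => Metric.isOpen_eball,
      isOpen_biUnion fun _ _ => Metric.isOpen_eball,
      fun x hx => mem_biUnion hx (Metric.mem_eball_self hr2),
      fun x hx => mem_biUnion hx (Metric.mem_eball_self hr2), ?_⟩
    rw [Set.disjoint_left]
    intro z hz hz'
    simp only [mem_iUnion, Metric.mem_eball] at hz hz'
    obtain ⟨x, hx, hzx⟩ := hz
    obtain ⟨y, hy, hzy⟩ := hz'
    have h1 : edist x y < r / 2 + r / 2 :=
      (edist_triangle_left x y z).trans_lt (ENNReal.add_lt_add hzx hzy)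
    rw [ENNReal.add_halves] at h1
    exact absurd (h x hx y hy) (not_le.2 h1)
  have split : ∀ A : Set X, variation μ u (A ∩ s) + variation μ u (A ∩ t) ≤ variation μ u A := by
    intro A
    conv_rhs => unfold variation
    refine le_iInf fun U => le_iInf fun hU => le_iInf fun hAU => ?_
    refine (add_le_add (?_ : _ ≤ totalVariation μ u (U ∩ S))
      (?_ : _ ≤ totalVariation μ u (U ∩ T))).trans
      (totalVariation_add_le μ u (hU.inter hT) inter_subset_left inter_subset_left
        (hd.mono inter_subset_right inter_subset_right))
    · exact iInf_le_of_le _ <| iInf_le_of_le (hU.inter hS) <|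
        iInf_le_of_le (inter_subset_inter hAU hsS) le_rfl
    · exact iInf_le_of_le _ <| iInf_le_of_le (hU.inter hT) <|
        iInf_le_of_le (inter_subset_inter hAU htT) le_rfl
  conv_rhs => rw [variationOuterMeasure, OuterMeasure.ofFunction_apply]
  refine le_iInf fun A => le_iInf fun hA => ?_
  have part : ∀ q : Set X, q ⊆ s ∪ t →
      variationOuterMeasure μ u q ≤ ∑' n, variation μ u (A n ∩ q) := by
    intro q hq
    rw [variationOuterMeasure, OuterMeasure.ofFunction_apply]
    refine iInf_le_of_le (fun n => A n ∩ q) (iInf_le_of_le ?_ le_rfl)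
    rw [← iUnion_inter]
    exact subset_inter (hq.trans hA) subset_rfl
  calc _ ≤ (∑' n, variation μ u (A n ∩ s)) + ∑' n, variation μ u (A n ∩ t) :=
        add_le_add (part s subset_union_left) (part t subset_union_right)
    _ = ∑' n, (variation μ u (A n ∩ s) + variation μ u (A n ∩ t)) := ENNReal.tsum_add.symm
    _ ≤ _ := ENNReal.tsum_le_tsum fun n => split (A n)

/-- The variation measure `‖Du‖(·)` as a Borel measure on `X`. -/
noncomputable def variationMeasure {X : Type*} [MetricSpace X] [MeasurableSpace X] [BorelSpace X]
    (μ : Measure X) (u : X → ℝ) : Measure X :=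
  (variationOuterMeasure μ u).toMeasure (variationOuterMeasure_isMetric μ u).le_caratheodory

/-- The characteristic function of `E`. -/
noncomputable def chi {X : Type*} (E : Set X) : X → ℝ := E.indicator fun _ => 1

/-- The perimeter measure `P(E, ·)`. -/
noncomputable def perimeterMeasure {X : Type*} [MetricSpace X] [MeasurableSpace X] [BorelSpace X]
    (μ : Measure X) (E : Set X) : Measure X :=
  variationMeasure μ (chi E)

/-- The restricted spherical Hausdorff content of codimension one (at most countable covers). -/
noncomputable def codimOneContent {X : Type*} [MetricSpace X] [MeasurableSpace X] (μ : Measure X)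
    (R : ℝ) (A : Set X) : ℝ≥0∞ :=
  ⨅ (s : Set (X × ℝ)) (_ : s.Countable) (_ : ∀ p ∈ s, 0 < p.2 ∧ p.2 ≤ R)
    (_ : A ⊆ ⋃ p ∈ s, Metric.ball p.1 p.2),
    ∑' p : s, μ (Metric.ball p.1.1 p.1.2) / ENNReal.ofReal p.1.2

/-- The codimension one Hausdorff measure; the contents increase as `R` decreases to `0`, so
that their limit is their supremum. -/
noncomputable def codimOneHausdorff {X : Type*} [MetricSpace X] [MeasurableSpace X]
    (μ : Measure X) (A : Set X) : ℝ≥0∞ :=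
  ⨆ (R : ℝ) (_ : 0 < R), codimOneContent μ R A

/-- The measure theoretic boundary `∂*E`. -/
def measureBoundary {X : Type*} [MetricSpace X] [MeasurableSpace X] (μ : Measure X)
    (E : Set X) : Set X :=
  {x | 0 < limsup (fun r : ℝ => μ (Metric.ball x r ∩ E) / μ (Metric.ball x r)) (𝓝[>] 0) ∧
    0 < limsup (fun r : ℝ => μ (Metric.ball x r \ E) / μ (Metric.ball x r)) (𝓝[>] 0)}

/-- The number `τ` is the trace of `u` at the boundary point `x` of `Ω`. -/
def IsTrace {X : Type*} [MetricSpace X] [MeasurableSpace X] (μ : Measure X)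
    (Ω : Set X) (u : X → ℝ) (x : X) (τ : ℝ) : Prop :=
  Tendsto (fun r : ℝ => ⨍⁻ y in Metric.ball x r ∩ Ω, ENNReal.ofReal |u y - τ| ∂μ)
    (𝓝[>] 0) (𝓝 0)

open Classical in
/-- The trace `Tu(x)`, and `0` where there is none. At a boundary point the trace is unique. -/
noncomputable def trace {X : Type*} [MetricSpace X] [MeasurableSpace X] (μ : Measure X)
    (Ω : Set X) (u : X → ℝ) (x : X) : ℝ :=
  if h : ∃ τ, IsTrace μ Ω u x τ then h.choose else 0

/-- Every `u ∈ BV(Ω)` has a trace at `ℋ`-almost every point of `∂*Ω`. -/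
def HasTraces {X : Type*} [MetricSpace X] [MeasurableSpace X] (μ : Measure X)
    (Ω : Set X) : Prop :=
  ∀ u : X → ℝ, BV μ u Ω →
    codimOneHausdorff μ {x ∈ measureBoundary μ Ω | ¬ ∃ τ, IsTrace μ Ω u x τ} = 0

/-- The functional `I(u) = ‖Du‖(Ω) + ∫_{∂*Ω} Tu f dP(Ω, ·)`, for `u ∈ BV(Ω)`. -/
noncomputable def functionalI {X : Type*} [MetricSpace X] [MeasurableSpace X] [BorelSpace X]
    (μ : Measure X) (Ω : Set X) (f : X → ℝ) (u : X → ℝ) : ℝ :=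
  (totalVariation μ u Ω).toReal +
    ∫ x in measureBoundary μ Ω, trace μ Ω u x * f x ∂(perimeterMeasure μ Ω)

/-- `u ∈ BV(Ω)` with `-1 ≤ u ≤ 1` almost everywhere in `Ω`. -/
def Admissible {X : Type*} [MetricSpace X] [MeasurableSpace X]
    (μ : Measure X) (Ω : Set X) (u : X → ℝ) : Prop :=
  BV μ u Ω ∧ ∀ᵐ x ∂(μ.restrict Ω), -1 ≤ u x ∧ u x ≤ 1

/-- `u` solves the restricted Neumann problem in `Ω` with boundary data `f`. -/
def IsSolution {X : Type*} [MetricSpace X] [MeasurableSpace X] [BorelSpace X]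
    (μ : Measure X) (Ω : Set X) (f : X → ℝ) (u : X → ℝ) : Prop :=
  Admissible μ Ω u ∧ ∀ v : X → ℝ, Admissible μ Ω v → functionalI μ Ω f u ≤ functionalI μ Ω f v

end MetricBV

/-! The functional is, up to an inequality in the right direction, an average over levels. By the
coarea inequality there is a measurable `G` with `‖Dχ_{u>t}‖(Ω) ≤ G t` for a.e. `t` and `∫ G ≤
‖Du‖(Ω)`. By Cavalieri's principle the boundary term of `u⁺` is the integral over `t ∈ (0,1)` of the
boundary terms of `χ_{u>t}`, and that of `u⁻` is the integral of those of `χ_{u<-t}`. With `A t`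
equal to `G t` plus the boundary term of `χ_{u>t}`, and `B t` equal to `G (-t)` minus that of
`χ_{u<-t}`, this gives `∫ A + ∫ B ≤ I(u)`. Subadditivity of the variation and additivity of traces
give `I(χ_{u>t₁} - χ_{u<-t₂}) ≤ A t₁ + B t₂` for a.e. `t₁`, `t₂` (`exists_level_majorants`).

Levels where `A` and `B` do not exceed their means give the first claim. If `u` is a solution, then
also `I(u) ≤ A t₁ + B t₂` for a.e. pair, which forces `A` and `B` to equal their means almost
everywhere (`ae_eq_integral_of_le_add`); so almost every pair of levels gives a minimizer.

Three facts carry this. The coarea inequality (`exists_coarea_majorant`) comes from composing the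
approximating functions with steep ramps, whose upper gradients live on thin bands of levels. Traces
exist `ℋ`-a.e. but are integrated against `P(Ω,·)`, so absolute continuity is needed
(`IsDoubling.perimeterMeasure_eq_zero`): if a compact `ℋ`-null set carried perimeter, covering it by
balls of small content would remove that perimeter at almost no cost, against lower semicontinuity.
Cavalieri's principle (`integral_trace_mul_eq`) is Fubini for averages over small balls, followed by
dominated convergence. -/

namespace MetricBV

/-! ### Doubling measures, compact exhaustions and locally Lipschitz functions. -/

section

variable {X : Type*} [MetricSpace X] [MeasurableSpace X] {μ : Measure X}

theorem IsDoubling.measure_ball_pos (hμ : IsDoubling μ) (x : X) {r : ℝ} (hr : 0 < r) :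
    0 < μ (Metric.ball x r) := by
  obtain ⟨C, -, h⟩ := hμ
  have := (h x (r / 2) (by positivity)).1
  rwa [mul_div_cancel₀ r two_ne_zero] at this

theorem IsDoubling.measure_ball_lt_top (hμ : IsDoubling μ) (x : X) (r : ℝ) :
    μ (Metric.ball x r) < ∞ := by
  obtain ⟨C, -, h⟩ := hμ
  exact (measure_mono (Metric.ball_subset_ball (le_max_left r 1))).trans_lt
    (h x (max r 1) (by positivity)).2.2

theorem IsDoubling.measure_lt_top (hμ : IsDoubling μ) {s : Set X} (hs : Bornology.IsBounded s) :
    μ s < ∞ := by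
  rcases s.eq_empty_or_nonempty with rfl | ⟨x, -⟩
  · simp
  obtain ⟨r, hr⟩ := hs.subset_ball x
  exact (measure_mono hr).trans_lt (hμ.measure_ball_lt_top x r)

theorem IsDoubling.isLocallyFiniteMeasure (hμ : IsDoubling μ) : IsLocallyFiniteMeasure μ :=
  ⟨fun x => ⟨Metric.ball x 1, Metric.ball_mem_nhds x one_pos, hμ.measure_ball_lt_top x 1⟩⟩

theorem IsDoubling.exists_measure_ball_pow_le (hμ : IsDoubling μ) :
    ∃ C : ℝ≥0, ∀ (n : ℕ) (x : X) (r : ℝ), 0 < r →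
      μ (Metric.ball x (2 ^ n * r)) ≤ (C : ℝ≥0∞) ^ n * μ (Metric.ball x r) := by
  obtain ⟨C, -, h⟩ := hμ
  refine ⟨C, fun n x r hr => ?_⟩
  induction n with
  | zero => simp
  | succ n ih =>
    rw [pow_succ', mul_assoc, pow_succ', mul_assoc]
    exact (h x _ (by positivity)).2.1.trans (mul_le_mul_right ih _)

/-- An infinite `ε`-separated sequence in a closed ball would give infinitely many disjoint balls of
radius `ε / 2` inside one ball of finite measure. By doubling their measures are bounded below by a
fixed positive number, a contradiction. -/
theorem IsDoubling.properSpace [BorelSpace X] [CompleteSpace X] (hμ : IsDoubling μ) :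
    ProperSpace X := by
  refine ⟨fun x r => TotallyBounded.isCompact_of_isClosed ?_ Metric.isClosed_closedBall⟩
  by_contra hnot
  rw [Metric.totallyBounded_iff] at hnot
  push Not at hnot
  obtain ⟨ε, hε, hcov⟩ := hnot
  obtain ⟨y, hy⟩ := seq_of_forall_finite_exists
    (P := fun c t => c ∈ Metric.closedBall x r ∧ ∀ z ∈ t, ε ≤ dist c z) (fun t ht => by
      obtain ⟨c, hc, hct⟩ := not_subset.1 (hcov t ht)
      refine ⟨c, hc, fun z hz => ?_⟩
      by_contra hlt
      exact hct (mem_biUnion hz (Metric.mem_ball.2 (not_le.1 hlt))))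
  obtain ⟨C, hC⟩ := hμ.exists_measure_ball_pow_le
  have hsep : Pairwise (Function.onFun Disjoint fun n => Metric.ball (y n) (ε / 2)) := by
    intro m n hmn
    refine Metric.ball_disjoint_ball ?_
    rw [add_halves]
    rcases lt_or_gt_of_ne hmn with h | h
    · rw [dist_comm]
      exact (hy n).2 _ ⟨m, h, rfl⟩
    · exact (hy m).2 _ ⟨n, h, rfl⟩
  obtain ⟨k, hk⟩ := pow_unbounded_of_one_lt ((r + r + 1) / (ε / 2)) (one_lt_two (α := ℝ))
  have hr : 0 ≤ r := dist_nonneg.trans (hy 0).1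
  have hlow : ∀ n, μ (Metric.ball x (r + 1)) ≤ (C : ℝ≥0∞) ^ k * μ (Metric.ball (y n) (ε / 2)) := by
    intro n
    refine (measure_mono (Metric.ball_subset_ball' ?_)).trans (hC k (y n) (ε / 2) (by positivity))
    have h1 : dist x (y n) ≤ r := by rw [dist_comm]; exact (hy n).1
    have h2 := (div_lt_iff₀ (half_pos hε)).1 hk
    linarith
  have hsum := tsum_meas_le_meas_iUnion_of_disjoint μ
    (fun n => Metric.isOpen_ball.measurableSet) hsep
  have hsub : (⋃ n, Metric.ball (y n) (ε / 2)) ⊆ Metric.ball x (r + ε / 2 + 1) := by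
    refine iUnion_subset fun n => Metric.ball_subset_ball' ?_
    have h1 : dist (y n) x ≤ r := (hy n).1
    linarith
  have hfin := (hsum.trans (measure_mono hsub)).trans_lt (hμ.measure_ball_lt_top x _)
  have h3 : (∑' _ : ℕ, μ (Metric.ball x (r + 1))) ≤
      (C : ℝ≥0∞) ^ k * ∑' n, μ (Metric.ball (y n) (ε / 2)) := by
    rw [← ENNReal.tsum_mul_left]
    exact ENNReal.tsum_le_tsum hlow
  rw [ENNReal.tsum_const_eq_top_of_ne_zero (hμ.measure_ball_pos x (by positivity)).ne'] at h3
  exact (h3.trans_lt (ENNReal.mul_lt_top (by finiteness) hfin)).ne rfl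

/-- The complement of the `1 / (k + 1)`-neighbourhood of `Ωᶜ`, intersected with a large ball. -/
def exhaustion {X : Type*} [MetricSpace X] (Ω : Set X) (x₀ : X) (k : ℕ) : Set X :=
  Metric.ball x₀ k ∩ {x | ENNReal.ofReal (1 / (k + 1)) < Metric.infEDist x Ωᶜ}

/-- The extended distance to an empty complement is `∞`, so that `Ω = univ` is included. -/
theorem compactlyInside_exhaustion {X : Type*} [MetricSpace X] [ProperSpace X] (Ω : Set X)
    (x₀ : X) (k : ℕ) : CompactlyInside (exhaustion Ω x₀ k) Ω := by
  have hsub : closure (exhaustion Ω x₀ k) ⊆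
      Metric.closedBall x₀ k ∩ {x | ENNReal.ofReal (1 / (k + 1)) ≤ Metric.infEDist x Ωᶜ} := by
    refine closure_minimal (inter_subset_inter Metric.ball_subset_closedBall fun x hx =>
      (le_of_lt (mem_ofPred.1 hx) :))
      (Metric.isClosed_closedBall.inter (isClosed_le continuous_const Metric.continuous_infEDist))
  refine ⟨Metric.isOpen_ball.inter (isOpen_lt continuous_const Metric.continuous_infEDist),
    (isCompact_closedBall x₀ (k : ℝ)).of_isClosed_subset isClosed_closure
      (hsub.trans inter_subset_left), fun x hx => ?_⟩
  by_contra hxΩ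
  have h : ENNReal.ofReal (1 / (k + 1)) ≤ Metric.infEDist x Ωᶜ := (hsub hx).2
  rw [Metric.infEDist_zero_of_mem hxΩ] at h
  have : (0 : ℝ) < 1 / (k + 1) := by positivity
  exact absurd (ENNReal.ofReal_pos.2 this) (not_lt.2 h)

theorem exhaustion_mono {X : Type*} [MetricSpace X] (Ω : Set X) (x₀ : X) :
    Monotone (exhaustion Ω x₀) := by
  intro k l hkl
  have h : (k : ℝ) ≤ l := by exact_mod_cast hkl
  refine inter_subset_inter (Metric.ball_subset_ball h) fun x hx => ?_
  refine lt_of_le_of_lt (ENNReal.ofReal_le_ofReal ?_) hx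
  gcongr

/-- Convergence in `L¹_loc` has to be tested only on this sequence of sets, which makes diagonal
arguments possible. -/
theorem exists_subset_exhaustion {X : Type*} [MetricSpace X] [ProperSpace X] {Ω : Set X}
    (hΩ : IsOpen Ω) (x₀ : X) {V : Set X} (hV : CompactlyInside V Ω) :
    ∃ k, V ⊆ exhaustion Ω x₀ k := by
  have hcov : closure V ⊆ ⋃ k, exhaustion Ω x₀ k := by
    intro x hx
    have hpos : 0 < Metric.infEDist x Ωᶜ := by
      refine (Metric.infEDist_pos_iff_notMem_closure).2 ?_
      rw [hΩ.isClosed_compl.closure_eq]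
      exact fun h => h (hV.2.2 hx)
    have h1 : Tendsto (fun k : ℕ => ENNReal.ofReal (1 / ((k : ℝ) + 1))) atTop (𝓝 0) := by
      simpa using ENNReal.tendsto_ofReal tendsto_one_div_add_atTop_nhds_zero_nat
    have h2 : ∀ᶠ k : ℕ in atTop, dist x x₀ < k :=
      tendsto_natCast_atTop_atTop.eventually_gt_atTop _
    obtain ⟨k, hk1, hk2⟩ := ((h1.eventually_lt_const hpos).and h2).exists
    exact mem_iUnion.2 ⟨k, hk2, hk1⟩
  obtain ⟨k, hk⟩ := hV.2.1.elim_directed_cover (exhaustion Ω x₀)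
    (fun k => (compactlyInside_exhaustion Ω x₀ k).1) hcov (exhaustion_mono Ω x₀).directed_le
  exact ⟨k, subset_closure.trans hk⟩

theorem exists_compactlyInside_mem {X : Type*} [MetricSpace X] [ProperSpace X] {Ω : Set X}
    (hΩ : IsOpen Ω) {x : X} (hx : x ∈ Ω) : ∃ U, CompactlyInside U Ω ∧ x ∈ U := by
  obtain ⟨r, hr, hrΩ⟩ := Metric.nhds_basis_closedBall.mem_iff.1 (hΩ.mem_nhds hx)
  refine ⟨Metric.ball x r, ⟨Metric.isOpen_ball, ?_, Metric.closure_ball_subset_closedBall.trans hrΩ⟩,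
    Metric.mem_ball_self hr⟩
  exact (isCompact_closedBall x r).of_isClosed_subset isClosed_closure
    Metric.closure_ball_subset_closedBall

theorem LipLoc.continuousOn {X : Type*} [MetricSpace X] [ProperSpace X] {Ω : Set X}
    (hΩ : IsOpen Ω) {u : X → ℝ} (hu : LipLoc u Ω) : ContinuousOn u Ω := by
  intro x hx
  obtain ⟨U, hU, hxU⟩ := exists_compactlyInside_mem hΩ hx
  obtain ⟨K, hK⟩ := hu U hU
  exact (hK.continuousOn.continuousAt (hU.1.mem_nhds hxU)).continuousWithinAt

theorem LipLoc.comp {X : Type*} [MetricSpace X] {Ω : Set X} {u : X → ℝ} (hu : LipLoc u Ω)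
    {φ : ℝ → ℝ} {L : ℝ≥0} (hφ : LipschitzWith L φ) : LipLoc (fun x => φ (u x)) Ω := fun U hU =>
  let ⟨K, hK⟩ := hu U hU
  ⟨L * K, hφ.comp_lipschitzOnWith hK⟩

theorem LipLoc.mono {X : Type*} [MetricSpace X] {Ω Ω' : Set X} {u : X → ℝ} (hu : LipLoc u Ω)
    (h : Ω' ⊆ Ω) : LipLoc u Ω' := fun U hU => hu U ⟨hU.1, hU.2.1, hU.2.2.trans h⟩

theorem LipLoc.congr {X : Type*} [MetricSpace X] {Ω : Set X} {u v : X → ℝ} (hu : LipLoc u Ω)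
    (h : EqOn u v Ω) : LipLoc v Ω := fun U hU =>
  let ⟨K, hK⟩ := hu U hU
  ⟨K, fun x hx y hy => by
    rw [← h (hU.2.2 (subset_closure hx)), ← h (hU.2.2 (subset_closure hy))]
    exact hK hx hy⟩

end

/-! ### Upper gradients along curves: truncation by ramps and maxima. -/

section

theorem hasUnitSpeedOn_comp_const_add {E : Type*} [PseudoEMetricSpace E] {γ : ℝ → E} {l a b : ℝ}
    (hγ : HasUnitSpeedOn γ (Icc 0 l)) (ha : 0 ≤ a) (hb : b ≤ l) :
    HasUnitSpeedOn (fun s => γ (a + s)) (Icc 0 (b - a)) := by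
  intro x hx y hy
  have h1 : Icc 0 (b - a) ∩ Icc x y = Icc x y :=
    inter_eq_right.2 (Icc_subset_Icc hx.1 hy.2)
  have h2 : Icc 0 l ∩ Icc (a + x) (a + y) = Icc (a + x) (a + y) :=
    inter_eq_right.2 (Icc_subset_Icc (by linarith [hx.1]) (by linarith [hy.2]))
  have h3 := hγ (x := a + x) ⟨by linarith [hx.1], by linarith [hx.2]⟩ (y := a + y)
    ⟨by linarith [hy.1], by linarith [hy.2]⟩
  rw [h2] at h3
  have h4 := eVariationOn.comp_eq_of_monotoneOn γ (t := Icc x y) (fun s => a + s)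
    (fun _ _ _ _ h => add_le_add_right h a)
  rw [image_const_add_Icc, h3] at h4
  rw [h1]
  refine h4.trans ?_
  congr 1
  ring

theorem edist_le_of_hasUnitSpeedOn {E : Type*} [PseudoEMetricSpace E] {γ : ℝ → E} {l : ℝ}
    (hγ : HasUnitSpeedOn γ (Icc 0 l)) {s t : ℝ} (hs : s ∈ Icc 0 l) (ht : t ∈ Icc 0 l)
    (hst : s ≤ t) : edist (γ s) (γ t) ≤ ENNReal.ofReal (t - s) := by
  have h := hγ hs ht
  rw [NNReal.coe_one, one_mul] at h
  rw [← h]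
  exact eVariationOn.edist_le γ ⟨hs, left_mem_Icc.2 hst⟩ ⟨ht, right_mem_Icc.2 hst⟩

theorem continuousOn_of_hasUnitSpeedOn {E : Type*} [PseudoEMetricSpace E] {γ : ℝ → E} {l : ℝ}
    (hγ : HasUnitSpeedOn γ (Icc 0 l)) : ContinuousOn γ (Icc 0 l) := by
  refine LipschitzOnWith.continuousOn (K := 1) fun s hs t ht => ?_
  rw [ENNReal.coe_one, one_mul, edist_dist s t, Real.dist_eq]
  rcases le_total s t with h | h
  · rw [abs_sub_comm, abs_of_nonneg (sub_nonneg.2 h)]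
    exact edist_le_of_hasUnitSpeedOn hγ hs ht h
  · rw [edist_comm, abs_of_nonneg (sub_nonneg.2 h)]
    exact edist_le_of_hasUnitSpeedOn hγ ht hs h

/-- Take for `t` the first time at which `f` reaches `q`, and for `s` the last time before `t` at
which `f` is at most `p`. -/
theorem exists_subinterval_of_le {f : ℝ → ℝ} {a b p q : ℝ} (hab : a ≤ b)
    (hf : ContinuousOn f (Icc a b)) (hpq : p ≤ q) (ha : f a ≤ p) (hb : q ≤ f b) :
    ∃ s t, a ≤ s ∧ s ≤ t ∧ t ≤ b ∧ f s = p ∧ f t = q ∧ ∀ x ∈ Icc s t, f x ∈ Icc p q := by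
  obtain ⟨t, ⟨htI, htq⟩, htl⟩ :=
    (isCompact_Icc.of_isClosed_subset (hf.preimage_isClosed_of_isClosed isClosed_Icc
      (isClosed_Ici (a := q))) inter_subset_left).exists_isLeast ⟨b, right_mem_Icc.2 hab, hb⟩
  have hft : f t = q := by
    obtain ⟨x, hx, hxq⟩ := intermediate_value_Icc htI.1
      (hf.mono (Icc_subset_Icc_right htI.2)) ⟨ha.trans hpq, htq⟩
    have : t ≤ x := htl ⟨⟨hx.1, hx.2.trans htI.2⟩, hxq.ge⟩
    rwa [le_antisymm hx.2 this] at hxq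
  have hf' : ContinuousOn f (Icc a t) := hf.mono (Icc_subset_Icc_right htI.2)
  obtain ⟨s, ⟨hsI, hsp⟩, hsg⟩ :=
    (isCompact_Icc.of_isClosed_subset (hf'.preimage_isClosed_of_isClosed isClosed_Icc
      (isClosed_Iic (a := p))) inter_subset_left).exists_isGreatest ⟨a, left_mem_Icc.2 htI.1, ha⟩
  have hfs : f s = p := by
    obtain ⟨x, hx, hxp⟩ := intermediate_value_Icc hsI.2
      (hf'.mono (Icc_subset_Icc_left hsI.1)) ⟨hsp, hpq.trans htq⟩
    have : x ≤ s := hsg ⟨⟨hsI.1.trans hx.1, hx.2⟩, hxp.le⟩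
    rwa [le_antisymm this hx.1] at hxp
  refine ⟨s, t, hsI.1, hsI.2, htI.2, hfs, hft, fun x hx => ⟨?_, ?_⟩⟩
  · rcases eq_or_lt_of_le hx.1 with rfl | h
    · exact hfs.ge
    · by_contra hlt
      exact absurd (hsg ⟨⟨hsI.1.trans hx.1, hx.2⟩, (not_le.1 hlt).le⟩) (not_le.2 h)
  · rcases eq_or_lt_of_le hx.2 with rfl | h
    · exact hft.le
    · by_contra hlt
      exact absurd (htl ⟨⟨hsI.1.trans hx.1, hx.2.trans htI.2⟩, (not_le.1 hlt).le⟩) (not_le.2 h)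

theorem exists_subinterval_of_ge {f : ℝ → ℝ} {a b p q : ℝ} (hab : a ≤ b)
    (hf : ContinuousOn f (Icc a b)) (hpq : p ≤ q) (ha : q ≤ f a) (hb : f b ≤ p) :
    ∃ s t, a ≤ s ∧ s ≤ t ∧ t ≤ b ∧ f s = q ∧ f t = p ∧ ∀ x ∈ Icc s t, f x ∈ Icc p q := by
  obtain ⟨s, t, h1, h2, h3, h4, h5, h6⟩ := exists_subinterval_of_le (f := fun x => -f x) hab hf.neg
    (neg_le_neg hpq) (neg_le_neg ha) (neg_le_neg hb)
  exact ⟨s, t, h1, h2, h3, neg_injective h4, neg_injective h5, fun x hx =>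
    ⟨neg_le_neg_iff.1 (h6 x hx).2, neg_le_neg_iff.1 (h6 x hx).1⟩⟩

/-- The function that is `0` up to `t`, `1` from `t + h` on, and affine in between. -/
noncomputable def ramp (t h a : ℝ) : ℝ := max 0 (min 1 ((a - t) / h))

theorem ramp_nonneg (t h a : ℝ) : 0 ≤ ramp t h a := le_max_left _ _

theorem ramp_le_one (t h a : ℝ) : ramp t h a ≤ 1 := max_le zero_le_one (min_le_left _ _)

theorem ramp_mono {h : ℝ} (hh : 0 < h) (t : ℝ) : Monotone (ramp t h) := fun a b hab =>
  max_le_max_left _ (min_le_min_left _ (by gcongr))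

theorem ramp_eq_zero {t h a : ℝ} (hh : 0 < h) (ha : a ≤ t) : ramp t h a = 0 :=
  max_eq_left ((min_le_right _ _).trans (div_nonpos_of_nonpos_of_nonneg (by linarith) hh.le))

theorem ramp_eq_one {t h a : ℝ} (hh : 0 < h) (ha : t + h ≤ a) : ramp t h a = 1 := by
  have : 1 ≤ (a - t) / h := (one_le_div hh).2 (by linarith)
  rw [ramp, min_eq_left this, max_eq_right zero_le_one]

theorem ramp_eq {t h a : ℝ} (hh : 0 < h) (h1 : t ≤ a) (h2 : a ≤ t + h) :
    ramp t h a = (a - t) / h := by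
  have h3 : (a - t) / h ≤ 1 := (div_le_one hh).2 (by linarith)
  have h4 : 0 ≤ (a - t) / h := div_nonneg (by linarith) hh.le
  rw [ramp, min_eq_right h3, max_eq_right h4]

theorem ramp_lipschitz (t h : ℝ) : LipschitzWith ‖h⁻¹‖₊ (ramp t h) := by
  have h1 : LipschitzWith ‖h⁻¹‖₊ fun a : ℝ => (a - t) / h :=
    LipschitzWith.of_dist_le_mul fun a b => by
      rw [Real.dist_eq, Real.dist_eq, coe_nnnorm, Real.norm_eq_abs, ← abs_mul]
      apply le_of_eq
      congr 1
      ring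
  exact (h1.const_min 1).const_max 0

/-- The ramp has slope `1 / h` on the band `[t, t + h]` and is constant off it. The change between
the end points is already achieved on one subinterval along which `f` stays in the band, so `G` is
needed only there. -/
theorem ofReal_abs_ramp_sub_le {f : ℝ → ℝ} {G : ℝ → ℝ≥0∞} {l t h : ℝ} (hl : 0 ≤ l) (hh : 0 < h)
    (hf : ContinuousOn f (Icc 0 l))
    (hG : ∀ a b, 0 ≤ a → a ≤ b → b ≤ l → ENNReal.ofReal |f a - f b| ≤ ∫⁻ s in Icc a b, G s) :
    ENNReal.ofReal |ramp t h (f 0) - ramp t h (f l)| ≤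
      ∫⁻ s in Icc 0 l, (f ⁻¹' Icc t (t + h)).indicator (fun s => G s / ENNReal.ofReal h) s := by
  have key : ∀ p q a b, t ≤ p → p ≤ q → q ≤ t + h → 0 ≤ a → a ≤ b → b ≤ l →
      |f a - f b| = q - p → (∀ s ∈ Icc a b, f s ∈ Icc p q) →
      ENNReal.ofReal ((q - p) / h) ≤
      ∫⁻ s in Icc 0 l, (f ⁻¹' Icc t (t + h)).indicator (fun s => G s / ENNReal.ofReal h) s := by
    intro p q a b hp hpq hq h0a hab hbl hfab hI
    calc ENNReal.ofReal ((q - p) / h)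
        = ENNReal.ofReal |f a - f b| / ENNReal.ofReal h := by
          rw [hfab, ENNReal.ofReal_div_of_pos hh]
      _ ≤ (∫⁻ s in Icc a b, G s) / ENNReal.ofReal h := by gcongr; exact hG a b h0a hab hbl
      _ = ∫⁻ s in Icc a b, G s / ENNReal.ofReal h := by
          simp only [div_eq_mul_inv]
          rw [lintegral_mul_const']
          exact ENNReal.inv_ne_top.2 (ENNReal.ofReal_pos.2 hh).ne'
      _ = ∫⁻ s in Icc a b, (f ⁻¹' Icc t (t + h)).indicator (fun s => G s / ENNReal.ofReal h) s := by
          refine setLIntegral_congr_fun measurableSet_Icc fun s hs => ?_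
          have : s ∈ f ⁻¹' Icc t (t + h) := Icc_subset_Icc hp hq (hI s hs)
          rw [indicator_of_mem this]
      _ ≤ _ := lintegral_mono_set (Icc_subset_Icc h0a hbl)
  rcases lt_trichotomy (ramp t h (f 0)) (ramp t h (f l)) with hlt | heq | hlt
  · have h1 : f 0 < t + h := by
      by_contra hge
      rw [ramp_eq_one hh (not_lt.1 hge)] at hlt
      exact absurd (ramp_le_one _ _ _) (not_le.2 hlt)
    have h2 : t < f l := by
      by_contra hge
      rw [ramp_eq_zero hh (not_lt.1 hge)] at hlt
      exact absurd (ramp_nonneg _ _ _) (not_le.2 hlt)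
    have h0l : f 0 < f l := (ramp_mono hh t).reflect_lt hlt
    have e1 : ramp t h (f 0) = (max t (f 0) - t) / h := by
      rcases le_total t (f 0) with h3 | h3
      · rw [max_eq_right h3, ramp_eq hh h3 h1.le]
      · rw [max_eq_left h3, ramp_eq_zero hh h3, sub_self, zero_div]
    have e2 : ramp t h (f l) = (min (t + h) (f l) - t) / h := by
      rcases le_total (t + h) (f l) with h3 | h3
      · rw [min_eq_left h3, ramp_eq_one hh h3, add_sub_cancel_left, div_self hh.ne']
      · rw [min_eq_right h3, ramp_eq hh h2.le h3]
    -- The end values of `f`, clamped to the band, serve as `p` and `q`.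
    have hpq : max t (f 0) ≤ min (t + h) (f l) :=
      max_le (le_min (by linarith) h2.le) (le_min h1.le h0l.le)
    obtain ⟨a, b, h3, h4, h5, h6, h7, h8⟩ :=
      exists_subinterval_of_le hl hf hpq (le_max_right _ _) (min_le_right _ _)
    have := key _ _ a b (le_max_left _ _) hpq (min_le_left _ _) h3 h4 h5
      (by rw [h6, h7, abs_sub_comm, abs_of_nonneg (sub_nonneg.2 hpq)]) h8
    rw [abs_sub_comm, abs_of_pos (sub_pos.2 hlt), e1, e2, ← sub_div]
    simpa using this
  · simp [heq]
  · have h1 : f l < t + h := by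
      by_contra hge
      rw [ramp_eq_one hh (not_lt.1 hge)] at hlt
      exact absurd (ramp_le_one _ _ _) (not_le.2 hlt)
    have h2 : t < f 0 := by
      by_contra hge
      rw [ramp_eq_zero hh (not_lt.1 hge)] at hlt
      exact absurd (ramp_nonneg _ _ _) (not_le.2 hlt)
    have h0l : f l < f 0 := (ramp_mono hh t).reflect_lt hlt
    have e1 : ramp t h (f l) = (max t (f l) - t) / h := by
      rcases le_total t (f l) with h3 | h3
      · rw [max_eq_right h3, ramp_eq hh h3 h1.le]
      · rw [max_eq_left h3, ramp_eq_zero hh h3, sub_self, zero_div]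
    have e2 : ramp t h (f 0) = (min (t + h) (f 0) - t) / h := by
      rcases le_total (t + h) (f 0) with h3 | h3
      · rw [min_eq_left h3, ramp_eq_one hh h3, add_sub_cancel_left, div_self hh.ne']
      · rw [min_eq_right h3, ramp_eq hh h2.le h3]
    have hpq : max t (f l) ≤ min (t + h) (f 0) :=
      max_le (le_min (by linarith) h2.le) (le_min h1.le h0l.le)
    obtain ⟨a, b, h3, h4, h5, h6, h7, h8⟩ :=
      exists_subinterval_of_ge hl hf hpq (min_le_right _ _) (le_max_right _ _)
    have := key _ _ a b (le_max_left _ _) hpq (min_le_left _ _) h3 h4 h5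
      (by rw [h6, h7, abs_of_nonneg (sub_nonneg.2 hpq)]) h8
    rw [abs_of_pos (sub_pos.2 hlt), e1, e2, ← sub_div]
    simpa using this

variable {X : Type*} [MetricSpace X] [MeasurableSpace X] {Ω : Set X} {g g' : X → ℝ≥0∞}
  {u v w : X → ℝ}

/-- A subcurve, shifted to start at time `0`, is again parametrized by arc length. -/
theorem IsUpperGradient.ofReal_abs_sub_le (hg : IsUpperGradient g u Ω) {l : ℝ} {γ : ℝ → X}
    (hγ : HasUnitSpeedOn γ (Icc 0 l)) (hin : ∀ s ∈ Icc 0 l, γ s ∈ Ω) {a b : ℝ} (ha : 0 ≤ a)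
    (hab : a ≤ b) (hb : b ≤ l) :
    ENNReal.ofReal |u (γ a) - u (γ b)| ≤ ∫⁻ s in Icc a b, g (γ s) := by
  rcases eq_or_lt_of_le hab with rfl | hlt
  · simp
  have h := hg.2 (b - a) (fun s => γ (a + s)) (sub_pos.2 hlt)
    (hasUnitSpeedOn_comp_const_add hγ ha hb)
    (fun s hs => hin _ ⟨by linarith [hs.1], by linarith [hs.2]⟩)
  rw [(measurePreserving_add_left volume a).setLIntegral_comp_emb
    (measurableEmbedding_addLeft a) (fun s => g (γ s)), image_const_add_Icc] at h
  simpa using h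

theorem IsUpperGradient.mono (hg : IsUpperGradient g u Ω) {Ω' : Set X} (h : Ω' ⊆ Ω) :
    IsUpperGradient g u Ω' :=
  ⟨hg.1, fun l γ hl hγ hin => hg.2 l γ hl hγ fun s hs => h (hin s hs)⟩

theorem IsUpperGradient.of_abs_sub_le (hg : IsUpperGradient g u Ω)
    (h : ∀ x ∈ Ω, ∀ y ∈ Ω, |w x - w y| ≤ |u x - u y|) : IsUpperGradient g w Ω :=
  ⟨hg.1, fun l γ hl hγ hin => (ENNReal.ofReal_le_ofReal (h _ (hin 0 (left_mem_Icc.2 hl.le)) _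
    (hin l (right_mem_Icc.2 hl.le)))).trans (hg.2 l γ hl hγ hin)⟩

theorem IsUpperGradient.congr (hg : IsUpperGradient g u Ω) (h : EqOn u w Ω) :
    IsUpperGradient g w Ω :=
  hg.of_abs_sub_le fun x hx y hy => by rw [h hx, h hy]

theorem IsUpperGradient.of_abs_sub_le_add (hg : IsUpperGradient g u Ω)
    (hg' : IsUpperGradient g' v Ω)
    (h : ∀ x ∈ Ω, ∀ y ∈ Ω, |w x - w y| ≤ |u x - u y| + |v x - v y|) :
    IsUpperGradient (fun x => g x + g' x) w Ω := by
  refine ⟨hg.1.add hg'.1, fun l γ hl hγ hin => ?_⟩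
  calc ENNReal.ofReal |w (γ 0) - w (γ l)|
      ≤ ENNReal.ofReal (|u (γ 0) - u (γ l)| + |v (γ 0) - v (γ l)|) :=
        ENNReal.ofReal_le_ofReal (h _ (hin 0 (left_mem_Icc.2 hl.le)) _
          (hin l (right_mem_Icc.2 hl.le)))
    _ ≤ _ := ENNReal.ofReal_add_le
    _ ≤ _ := add_le_add (hg.2 l γ hl hγ hin) (hg'.2 l γ hl hγ hin)
    _ ≤ _ := le_lintegral_add _ _

theorem abs_max_sub_max_le_add (a b c d : ℝ) : |max a b - max c d| ≤ |a - c| + |b - d| :=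
  (abs_max_sub_max_le_max a b c d).trans
    (max_le (le_add_of_nonneg_right (abs_nonneg _)) (le_add_of_nonneg_left (abs_nonneg _)))

theorem IsUpperGradient.max (hg : IsUpperGradient g u Ω) (hg' : IsUpperGradient g' v Ω) :
    IsUpperGradient (fun x => g x + g' x) (fun x => max (u x) (v x)) Ω :=
  hg.of_abs_sub_le_add hg' fun _ _ _ _ => abs_max_sub_max_le_add _ _ _ _

theorem IsUpperGradient.ramp (hg : IsUpperGradient g u Ω) (hu : ContinuousOn u Ω)
    (hum : Measurable u) {t h : ℝ} (hh : 0 < h) :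
    IsUpperGradient ((u ⁻¹' Icc t (t + h)).indicator fun x => g x / ENNReal.ofReal h)
      (fun x => ramp t h (u x)) Ω := by
  refine ⟨(hg.1.div_const _).indicator (hum measurableSet_Icc), fun l γ hl hγ hin => ?_⟩
  exact ofReal_abs_ramp_sub_le (f := fun s => u (γ s)) (G := fun s => g (γ s)) hl.le hh
    (hu.comp (continuousOn_of_hasUnitSpeedOn hγ) hin)
    (fun a b ha hab hb => hg.ofReal_abs_sub_le hγ hin ha hab hb)

theorem isUpperGradient_dist (x : X) : IsUpperGradient (fun _ => 1) (fun y => dist y x) Ω := by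
  refine ⟨measurable_const, fun l γ hl hγ _ => ?_⟩
  have h := edist_le_of_hasUnitSpeedOn hγ (left_mem_Icc.2 hl.le) (right_mem_Icc.2 hl.le) hl.le
  rw [sub_zero] at h
  calc ENNReal.ofReal |dist (γ 0) x - dist (γ l) x| ≤ ENNReal.ofReal (dist (γ 0) (γ l)) :=
        ENNReal.ofReal_le_ofReal (abs_dist_sub_le _ _ _)
    _ = edist (γ 0) (γ l) := (edist_dist _ _).symm
    _ ≤ ENNReal.ofReal l := h
    _ = _ := by simp

/-- Where the larger function takes its maximal value `1`, the other one does not contribute to the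
upper gradient of the maximum. -/
theorem IsUpperGradient.max_of_le_one [BorelSpace X] (hg : IsUpperGradient g u Ω)
    (hg' : IsUpperGradient g' v Ω) (hu : ∀ x ∈ Ω, u x ≤ 1) (hvc : Continuous v) :
    IsUpperGradient (fun x => {x | v x ≠ 1}.indicator g x + g' x)
      (fun x => Max.max (u x) (v x)) Ω := by
  have hFm : MeasurableSet {x | v x ≠ 1} :=
    (isClosed_eq hvc continuous_const).measurableSet.compl
  refine ⟨(hg.1.indicator hFm).add hg'.1, fun l γ hl hγ hin => ?_⟩
  have hvγ : ContinuousOn (fun s => v (γ s)) (Icc 0 l) :=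
    hvc.comp_continuousOn (continuousOn_of_hasUnitSpeedOn hγ)
  have piece : ∀ a b, 0 ≤ a → a ≤ b → b ≤ l → (∀ s ∈ Ioo a b, v (γ s) ≠ 1) →
      ENNReal.ofReal |Max.max (u (γ a)) (v (γ a)) - Max.max (u (γ b)) (v (γ b))| ≤
        ∫⁻ s in Ioo a b, ({x | v x ≠ 1}.indicator g (γ s) + g' (γ s)) := by
    intro a b ha hab hb hne
    refine ((hg.max hg').ofReal_abs_sub_le hγ hin ha hab hb).trans ?_
    rw [← restrict_Ioo_eq_restrict_Icc]
    refine (setLIntegral_congr_fun measurableSet_Ioo fun s hs => ?_).le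
    have : γ s ∈ {x | v x ≠ 1} := hne s hs
    rw [indicator_of_mem this]
  by_cases hall : ∀ s ∈ Icc 0 l, v (γ s) ≠ 1
  · refine (piece 0 l le_rfl hl.le le_rfl fun s hs => hall s (Ioo_subset_Icc_self hs)).trans ?_
    exact lintegral_mono_set Ioo_subset_Icc_self
  · push Not at hall
    obtain ⟨s₀, hs₀, hvs₀⟩ := hall
    -- Cut the curve at the first and the last time at which `v = 1`. At both the maximum equals
    -- `1`, since `u ≤ 1`, so the part in between contributes nothing to the difference of the end
    -- values.
    have hcomp : IsCompact (Icc 0 l ∩ (fun s => v (γ s)) ⁻¹' {1}) :=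
      isCompact_Icc.of_isClosed_subset (hvγ.preimage_isClosed_of_isClosed isClosed_Icc
        isClosed_singleton) inter_subset_left
    obtain ⟨a, ⟨haI, hva⟩, hal⟩ := hcomp.exists_isLeast ⟨s₀, hs₀, hvs₀⟩
    obtain ⟨b, ⟨hbI, hvb⟩, hbg⟩ := hcomp.exists_isGreatest ⟨s₀, hs₀, hvs₀⟩
    have hab : a ≤ b := (hal ⟨hs₀, hvs₀⟩).trans (hbg ⟨hs₀, hvs₀⟩)
    have hva : v (γ a) = 1 := hva
    have hvb : v (γ b) = 1 := hvb
    have p1 := piece 0 a le_rfl haI.1 haI.2 fun s hs h =>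
      absurd (hal ⟨⟨hs.1.le, hs.2.le.trans haI.2⟩, h⟩) (not_le.2 hs.2)
    have p2 := piece b l hbI.1 hbI.2 le_rfl fun s hs h =>
      absurd (hbg ⟨⟨hbI.1.trans hs.1.le, hs.2.le⟩, h⟩) (not_le.2 hs.1)
    rw [hva, max_eq_right (hu _ (hin a haI))] at p1
    rw [hvb, max_eq_right (hu _ (hin b hbI))] at p2
    have hsub : Ioo 0 a ∪ Ioo b l ⊆ Icc 0 l :=
      union_subset (fun s hs => ⟨hs.1.le, hs.2.le.trans haI.2⟩)
        fun s hs => ⟨hbI.1.trans hs.1.le, hs.2.le⟩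
    calc ENNReal.ofReal |Max.max (u (γ 0)) (v (γ 0)) - Max.max (u (γ l)) (v (γ l))|
        ≤ ENNReal.ofReal (|Max.max (u (γ 0)) (v (γ 0)) - 1| +
            |1 - Max.max (u (γ l)) (v (γ l))|) := ENNReal.ofReal_le_ofReal (abs_sub_le _ _ _)
      _ ≤ _ := ENNReal.ofReal_add_le
      _ ≤ _ := add_le_add p1 p2
      _ = ∫⁻ s in Ioo 0 a ∪ Ioo b l, ({x | v x ≠ 1}.indicator g (γ s) + g' (γ s)) :=
          (lintegral_union measurableSet_Ioo (Set.disjoint_left.2 fun s hs hs' =>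
            absurd (hs.2.trans_le hab) (not_lt.2 hs'.1.le))).symm
      _ ≤ _ := lintegral_mono_set hsub

end

/-! ### Total variation: lower semicontinuity, subadditivity and the coarea inequality. -/

section

/-- The two functions of `t` agree outside the interval from `min (a - h) b` to `max a b`, differ by
at most `1` on it, and its length is at most `|a - b| + h`. -/
theorem lintegral_abs_ramp_sub_le {h : ℝ} (hh : 0 < h) (a b : ℝ) :
    ∫⁻ t, ENNReal.ofReal |ramp t h a - (Iio b).indicator (fun _ => 1) t| ≤
      ENNReal.ofReal |a - b| + ENNReal.ofReal h := by
  calc ∫⁻ t, ENNReal.ofReal |ramp t h a - (Iio b).indicator (fun _ => 1) t|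
      ≤ ∫⁻ t, (Icc (min (a - h) b) (max a b)).indicator (fun _ => 1) t := by
        refine lintegral_mono fun t => ?_
        by_cases ht : t ∈ Icc (min (a - h) b) (max a b)
        · rw [indicator_of_mem ht]
          refine ENNReal.ofReal_le_one.2 ?_
          have h1 := ramp_nonneg t h a
          have h2 := ramp_le_one t h a
          by_cases hb : t ∈ Iio b
          · rw [indicator_of_mem hb, abs_le]
            constructor <;> linarith
          · rw [indicator_of_notMem hb, abs_le]
            constructor <;> linarith
        · rw [mem_Icc, not_and_or, not_le, not_le, lt_min_iff, max_lt_iff] at ht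
          rcases ht with ht | ht
          · rw [ramp_eq_one hh (by linarith), indicator_of_mem (show t ∈ Iio b from ht.2)]
            simp
          · rw [ramp_eq_zero hh ht.1.le, indicator_of_notMem (show t ∉ Iio b from not_lt.2 ht.2.le)]
            simp
    _ = ENNReal.ofReal (max a b - min (a - h) b) := by
        rw [lintegral_indicator measurableSet_Icc]
        simp
    _ ≤ ENNReal.ofReal (|a - b| + h) := by
        refine ENNReal.ofReal_le_ofReal ?_
        have h1 : min a b - h ≤ min (a - h) b :=
          le_min (by linarith [min_le_left a b]) (by linarith [min_le_right a b])
        have h2 := max_sub_min_eq_abs a b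
        rw [abs_sub_comm] at h2
        linarith
    _ ≤ _ := ENNReal.ofReal_add_le

theorem chi_setOf_lt {X : Type*} (u : X → ℝ) (t : ℝ) (x : X) :
    chi {y | t < u y} x = (Iio (u x)).indicator (fun _ => 1) t := by
  by_cases h : t < u x
  · rw [chi, indicator_of_mem (show x ∈ {y | t < u y} from h),
      indicator_of_mem (show t ∈ Iio (u x) from h)]
  · rw [chi, indicator_of_notMem (show x ∉ {y | t < u y} from h),
      indicator_of_notMem (show t ∉ Iio (u x) from h)]

theorem measurable_chi_setOf_lt {X : Type*} [MeasurableSpace X] {u : X → ℝ} (hu : Measurable u) :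
    Measurable fun p : ℝ × X => chi {y | p.1 < u y} p.2 := by
  have : (fun p : ℝ × X => chi {y | p.1 < u y} p.2) =
      {p : ℝ × X | p.1 < u p.2}.indicator fun _ => 1 := by
    ext p
    by_cases h : p.1 < u p.2
    · rw [chi, indicator_of_mem (show p.2 ∈ {y | p.1 < u y} from h),
        indicator_of_mem (show p ∈ {p : ℝ × X | p.1 < u p.2} from h)]
    · rw [chi, indicator_of_notMem (show p.2 ∉ {y | p.1 < u y} from h),
        indicator_of_notMem (show p ∉ {p : ℝ × X | p.1 < u p.2} from h)]
  rw [this]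
  exact measurable_const.indicator (measurableSet_lt measurable_fst (hu.comp measurable_snd))

theorem measurable_ramp_comp {X : Type*} [MeasurableSpace X] {v : X → ℝ} (hv : Measurable v) (h : ℝ) :
    Measurable fun p : ℝ × X => ramp p.1 h (v p.2) :=
  measurable_const.max (measurable_const.min (((hv.comp measurable_snd).sub measurable_fst).div_const h))

theorem measurable_indicator_preimage_Icc {X : Type*} [MeasurableSpace X] {v : X → ℝ}
    {g : X → ℝ≥0∞} (hg : Measurable g) (hv : Measurable v) (h : ℝ) : Measurable fun p : ℝ × X =>
      (v ⁻¹' Icc p.1 (p.1 + h)).indicator (fun x => g x / ENNReal.ofReal h) p.2 := by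
  have : (fun p : ℝ × X =>
      (v ⁻¹' Icc p.1 (p.1 + h)).indicator (fun x => g x / ENNReal.ofReal h) p.2) =
      {p : ℝ × X | p.1 ≤ v p.2 ∧ v p.2 ≤ p.1 + h}.indicator
        fun p => g p.2 / ENNReal.ofReal h := by
    ext p
    by_cases hp : p.1 ≤ v p.2 ∧ v p.2 ≤ p.1 + h
    · rw [indicator_of_mem (show p.2 ∈ v ⁻¹' Icc p.1 (p.1 + h) from hp),
        indicator_of_mem (show p ∈ {p : ℝ × X | p.1 ≤ v p.2 ∧ v p.2 ≤ p.1 + h} from hp)]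
    · rw [indicator_of_notMem (show p.2 ∉ v ⁻¹' Icc p.1 (p.1 + h) from hp),
        indicator_of_notMem (show p ∉ {p : ℝ × X | p.1 ≤ v p.2 ∧ v p.2 ≤ p.1 + h} from hp)]
  rw [this]
  exact ((hg.comp measurable_snd).div_const _).indicator
    ((measurableSet_le measurable_fst (hv.comp measurable_snd)).inter
      (measurableSet_le (hv.comp measurable_snd) (measurable_fst.add_const h)))

theorem lintegral_lintegral_ramp_sub_chi_le {X : Type*} [MeasurableSpace X] {μ : Measure X}
    [SFinite μ] {u v : X → ℝ} (hu : Measurable u) (hv : Measurable v)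
    {h : ℝ} (hh : 0 < h) (U : Set X) :
    ∫⁻ t, ∫⁻ x in U, ENNReal.ofReal |ramp t h (v x) - chi {y | t < u y} x| ∂μ ≤
      (∫⁻ x in U, ENNReal.ofReal |v x - u x| ∂μ) + ENNReal.ofReal h * μ U := by
  rw [lintegral_lintegral_swap
    ((measurable_ramp_comp hv h).sub (measurable_chi_setOf_lt hu)).abs.ennreal_ofReal.aemeasurable]
  calc _ ≤ ∫⁻ x in U, (ENNReal.ofReal |v x - u x| + ENNReal.ofReal h) ∂μ := by
        refine lintegral_mono fun x => ?_
        simp only [chi_setOf_lt]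
        exact lintegral_abs_ramp_sub_le hh _ _
    _ = _ := by
        rw [lintegral_add_right _ measurable_const, setLIntegral_const]

/-- For fixed `x` the levels `t` whose band contains `v x` form an interval of length `h`, which
cancels the factor `1 / h`. -/
theorem lintegral_lintegral_indicator_preimage_Icc {X : Type*} [MeasurableSpace X]
    {μ : Measure X} [SFinite μ] {v : X → ℝ} {g : X → ℝ≥0∞} (hg : Measurable g)
    (hv : Measurable v) {h : ℝ} (hh : 0 < h) (U : Set X) :
    ∫⁻ t, ∫⁻ x in U, (v ⁻¹' Icc t (t + h)).indicator (fun x => g x / ENNReal.ofReal h) x ∂μ =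
      ∫⁻ x in U, g x ∂μ := by
  rw [lintegral_lintegral_swap (measurable_indicator_preimage_Icc hg hv h).aemeasurable]
  refine lintegral_congr fun x => ?_
  have : (fun t => (v ⁻¹' Icc t (t + h)).indicator (fun x => g x / ENNReal.ofReal h) x) =
      (Icc (v x - h) (v x)).indicator fun _ => g x / ENNReal.ofReal h := by
    ext t
    have hiff : x ∈ v ⁻¹' Icc t (t + h) ↔ t ∈ Icc (v x - h) (v x) :=
      ⟨fun h' => ⟨sub_le_iff_le_add.2 h'.2, h'.1⟩, fun h' => ⟨h'.2, sub_le_iff_le_add.1 h'.1⟩⟩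
    by_cases hx : x ∈ v ⁻¹' Icc t (t + h)
    · rw [indicator_of_mem hx, indicator_of_mem (hiff.1 hx)]
    · rw [indicator_of_notMem hx, indicator_of_notMem (mt hiff.2 hx)]
  rw [this, lintegral_indicator measurableSet_Icc, setLIntegral_const, Real.volume_Icc,
    sub_sub_cancel]
  exact ENNReal.div_mul_cancel (ENNReal.ofReal_pos.2 hh).ne' ENNReal.ofReal_ne_top

variable {X : Type*} [MetricSpace X] [MeasurableSpace X] {μ : Measure X} {Ω : Set X}
  {u v w : X → ℝ} {c : ℝ≥0∞}

theorem totalVariation_le_liminf {v : ℕ → X → ℝ} {g : ℕ → X → ℝ≥0∞} (h1 : ∀ i, LipLoc (v i) Ω)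
    (h2 : ∀ i, IsUpperGradient (g i) (v i) Ω) (h3 : TendstoL1Loc μ v u Ω) :
    totalVariation μ u Ω ≤ liminf (fun i => ∫⁻ x in Ω, g i x ∂μ) atTop :=
  iInf_le_of_le v <| iInf_le_of_le g <| iInf_le_of_le h1 <| iInf_le_of_le h2 <|
    iInf_le_of_le h3 le_rfl

theorem totalVariation_le_of_frequently_le {v : ℕ → X → ℝ} {g : ℕ → X → ℝ≥0∞}
    (h1 : ∀ i, LipLoc (v i) Ω) (h2 : ∀ i, IsUpperGradient (g i) (v i) Ω)
    (h3 : TendstoL1Loc μ v u Ω) (h4 : ∃ᶠ i in atTop, ∫⁻ x in Ω, g i x ∂μ ≤ c) :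
    totalVariation μ u Ω ≤ c :=
  (totalVariation_le_liminf h1 h2 h3).trans (liminf_le_of_frequently_le h4)

theorem TendstoL1Loc.congr_ae {v : ℕ → X → ℝ} (h : TendstoL1Loc μ v u Ω)
    (huw : u =ᵐ[μ.restrict Ω] w) : TendstoL1Loc μ v w Ω := by
  intro U hU
  refine (h U hU).congr fun i => lintegral_congr_ae ?_
  filter_upwards [ae_restrict_of_ae_restrict_of_subset (subset_closure.trans hU.2.2) huw] with x hx
  rw [hx]

theorem TendstoL1Loc.congr [BorelSpace X] {v v' : ℕ → X → ℝ} (h : TendstoL1Loc μ v u Ω)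
    (hv : ∀ i, EqOn (v i) (v' i) Ω) : TendstoL1Loc μ v' u Ω := by
  intro U hU
  refine (h U hU).congr fun i => ?_
  have : ∀ᵐ x ∂(μ.restrict U), x ∈ Ω :=
    (ae_restrict_mem hU.1.measurableSet).mono fun x hx => hU.2.2 (subset_closure hx)
  refine lintegral_congr_ae ?_
  filter_upwards [this] with x hx
  rw [hv i hx]

theorem totalVariation_congr_ae (huw : u =ᵐ[μ.restrict Ω] w) :
    totalVariation μ u Ω = totalVariation μ w Ω := by
  have : ∀ v : ℕ → X → ℝ, TendstoL1Loc μ v u Ω ↔ TendstoL1Loc μ v w Ω := fun v =>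
    ⟨fun h => h.congr_ae huw, fun h => h.congr_ae huw.symm⟩
  simp only [totalVariation, this]

/-- Used to pass from superlevel sets to sublevel sets. -/
theorem totalVariation_one_sub_le : totalVariation μ (fun x => 1 - u x) Ω ≤ totalVariation μ u Ω := by
  conv_rhs => unfold totalVariation
  refine le_iInf fun v => le_iInf fun g => le_iInf fun h1 => le_iInf fun h2 => le_iInf fun h3 => ?_
  refine totalVariation_le_liminf (v := fun i x => 1 - v i x) (fun i U hU => ?_)
    (fun i => (h2 i).of_abs_sub_le fun x _ y _ => ?_) fun U hU => (h3 U hU).congr fun i => ?_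
  · obtain ⟨K, hK⟩ := h1 i U hU
    exact ⟨K, LipschitzOnWith.of_dist_le_mul fun x hx y hy => by
      rw [dist_sub_left]
      exact hK.dist_le_mul x hx y hy⟩
  · rw [sub_sub_sub_cancel_left, abs_sub_comm]
  · simp only [sub_sub_sub_cancel_left, abs_sub_comm]

section

variable [BorelSpace X] [ProperSpace X]

theorem exists_seq_of_totalVariation_lt (hΩ : IsOpen Ω) (h : totalVariation μ u Ω < c) :
    ∃ (v : ℕ → X → ℝ) (g : ℕ → X → ℝ≥0∞), (∀ i, LipLoc (v i) Ω) ∧ (∀ i, Measurable (v i)) ∧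
      (∀ i, IsUpperGradient (g i) (v i) Ω) ∧ TendstoL1Loc μ v u Ω ∧
      ∀ i, ∫⁻ x in Ω, g i x ∂μ < c := by
  classical
  simp only [totalVariation, iInf_lt_iff] at h
  obtain ⟨v, g, h1, h2, h3, h4⟩ := h
  obtain ⟨φ, hφ, hφc⟩ := extraction_of_frequently_atTop
    (frequently_lt_of_liminf_lt (by isBoundedDefault) h4)
  -- The approximating functions are controlled only in `Ω`. Setting them to `0` elsewhere makes
  -- them Borel on `X` without changing anything in `Ω`.
  have heq : ∀ i, EqOn (v (φ i)) (Ω.indicator (v (φ i))) Ω := fun i x hx =>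
    (indicator_of_mem hx _).symm
  refine ⟨fun i => Ω.indicator (v (φ i)), fun i => g (φ i), fun i => (h1 _).congr (heq i), fun i => ?_,
    fun i => (h2 _).congr (heq i),
    TendstoL1Loc.congr (v := fun i => v (φ i)) (fun U hU => (h3 U hU).comp hφ.tendsto_atTop) heq, hφc⟩
  simp only [← piecewise_eq_indicator]
  exact ((h1 _).continuousOn hΩ).measurable_piecewise continuousOn_const hΩ.measurableSet

/-- Lower semicontinuity, by a diagonal argument: from the sequence approximating `w k`, take a
member within `1 / (k + 1)` of it in `L¹` on the `k`-th set of the exhaustion. -/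
theorem totalVariation_le_of_tendsto [Nonempty X] (hΩ : IsOpen Ω) {w : ℕ → X → ℝ}
    (hwm : ∀ k, AEMeasurable (w k) (μ.restrict Ω)) (hw : ∀ k, totalVariation μ (w k) Ω < c)
    (hconv : TendstoL1Loc μ w u Ω) : totalVariation μ u Ω ≤ c := by
  have x₀ : X := Classical.arbitrary X
  choose v g h1 h1m h2 h3 h4 using fun k => exists_seq_of_totalVariation_lt hΩ (hw k)
  have hpos : ∀ k : ℕ, (0 : ℝ≥0∞) < ((k : ℝ≥0∞) + 1)⁻¹ := fun k => by simp
  have hi : ∀ k, ∃ i, ∫⁻ x in exhaustion Ω x₀ k, ENNReal.ofReal |v k i x - w k x| ∂μ <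
      ((k : ℝ≥0∞) + 1)⁻¹ := fun k =>
    ((h3 k _ (compactlyInside_exhaustion Ω x₀ k)).eventually_lt_const (hpos k)).exists
  choose i hi using hi
  refine totalVariation_le_of_frequently_le (v := fun k => v k (i k)) (g := fun k => g k (i k))
    (fun k => h1 _ _) (fun k => h2 _ _) (fun V hV => ?_) (Frequently.of_forall fun k => (h4 _ _).le)
  obtain ⟨k₀, hk₀⟩ := exists_subset_exhaustion hΩ x₀ hV
  have hlim : Tendsto (fun k : ℕ => ((k : ℝ≥0∞) + 1)⁻¹ +
      ∫⁻ x in V, ENNReal.ofReal |w k x - u x| ∂μ) atTop (𝓝 0) := by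
    have h := (ENNReal.tendsto_inv_nat_nhds_zero.comp (tendsto_add_atTop_nat 1)).add (hconv V hV)
    simpa [Function.comp_def] using h
  refine tendsto_of_tendsto_of_tendsto_of_le_of_le' tendsto_const_nhds hlim
    (Eventually.of_forall fun _ => zero_le) ?_
  filter_upwards [eventually_ge_atTop k₀] with k hk
  have hVΩ : V ⊆ Ω := subset_closure.trans hV.2.2
  have hm : AEMeasurable (fun x => ENNReal.ofReal |v k (i k) x - w k x|) (μ.restrict V) :=
    (((h1m k (i k)).aemeasurable.sub ((hwm k).mono_set hVΩ)).abs).ennreal_ofReal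
  calc ∫⁻ x in V, ENNReal.ofReal |v k (i k) x - u x| ∂μ
      ≤ ∫⁻ x in V, (ENNReal.ofReal |v k (i k) x - w k x| + ENNReal.ofReal |w k x - u x|) ∂μ := by
        refine lintegral_mono fun x => ?_
        rw [← ENNReal.ofReal_add (abs_nonneg _) (abs_nonneg _)]
        exact ENNReal.ofReal_le_ofReal (abs_sub_le _ _ _)
    _ = _ := lintegral_add_left' hm _
    _ ≤ _ := add_le_add_left ((lintegral_mono_set
        (hk₀.trans (exhaustion_mono Ω x₀ hk))).trans (hi k).le) _

theorem totalVariation_sub_le (hΩ : IsOpen Ω) (hu : AEMeasurable u (μ.restrict Ω)) :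
    totalVariation μ (fun x => u x - v x) Ω ≤ totalVariation μ u Ω + totalVariation μ v Ω := by
  refine ENNReal.le_of_forall_pos_le_add fun ε hε hfin => ?_
  obtain ⟨hu1, hv1⟩ := ENNReal.add_lt_top.1 hfin
  have hε2 : ((ε / 2 : ℝ≥0) : ℝ≥0∞) ≠ 0 := by simpa using hε.ne'
  obtain ⟨a, g, a1, am, a2, a3, a4⟩ := exists_seq_of_totalVariation_lt hΩ
    (ENNReal.lt_add_right hu1.ne hε2)
  obtain ⟨b, k, b1, bm, b2, b3, b4⟩ := exists_seq_of_totalVariation_lt hΩ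
    (ENNReal.lt_add_right hv1.ne hε2)
  have hsplit : ∀ p q r s : ℝ, |p - q - (r - s)| ≤ |p - r| + |q - s| := fun p q r s => by
    rw [sub_sub_sub_comm]
    exact abs_sub _ _
  refine totalVariation_le_of_frequently_le (v := fun i x => a i x - b i x)
    (g := fun i x => g i x + k i x) (fun i U hU => ?_)
    (fun i => (a2 i).of_abs_sub_le_add (b2 i) fun x _ y _ => hsplit _ _ _ _) (fun U hU => ?_)
    (Frequently.of_forall fun i => ?_)
  · obtain ⟨K, hK⟩ := a1 i U hU
    obtain ⟨L, hL⟩ := b1 i U hU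
    exact ⟨K + L, hK.sub hL⟩
  · have h := (a3 U hU).add (b3 U hU)
    rw [add_zero] at h
    refine tendsto_of_tendsto_of_tendsto_of_le_of_le tendsto_const_nhds h (fun _ => zero_le)
      fun i => ?_
    have hm : AEMeasurable (fun x => ENNReal.ofReal |a i x - u x|) (μ.restrict U) :=
      (((am i).aemeasurable.sub
        (hu.mono_set (subset_closure.trans hU.2.2))).abs).ennreal_ofReal
    rw [← lintegral_add_left' hm]
    refine lintegral_mono fun x => ?_
    rw [← ENNReal.ofReal_add (abs_nonneg _) (abs_nonneg _)]
    exact ENNReal.ofReal_le_ofReal (hsplit _ _ _ _)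
  · rw [lintegral_add_left (a2 i).1]
    refine (add_le_add (a4 i).le (b4 i).le).trans (le_of_eq ?_)
    rw [add_add_add_comm, ← ENNReal.coe_add, add_halves]

/-- The ramps of width `h i`, composed with the approximating functions, approximate `χ_{u>t}` in
`L¹_loc` for a.e. `t` along suitable indices. The integrals of their upper gradients, integrated
over `t`, give back `∫ g i`, and Fatou's lemma bounds the integral of the lower limit. Working with
a majorant `G` avoids the question of measurability of the total variation in `t`. -/
theorem exists_coarea_majorant_of_lt [Nonempty X] [SFinite μ] [IsLocallyFiniteMeasure μ]
    (hΩ : IsOpen Ω) (hu : Measurable u) (hc : totalVariation μ u Ω < c) :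
    ∃ G : ℝ → ℝ≥0∞, Measurable G ∧ ∫⁻ t, G t ≤ c ∧
      ∀ᵐ t, totalVariation μ (chi {y | t < u y}) Ω ≤ G t := by
  have x₀ : X := Classical.arbitrary X
  obtain ⟨v, g, h1, hvm, h2, h3, h4⟩ := exists_seq_of_totalVariation_lt hΩ hc
  set h : ℕ → ℝ := fun i => 1 / ((i : ℝ) + 1) with hdef
  have hh : ∀ i, 0 < h i := fun i => by positivity
  set D : ℕ → ℕ → ℝ → ℝ≥0∞ := fun k i t =>
    ∫⁻ x in exhaustion Ω x₀ k, ENNReal.ofReal |ramp t (h i) (v i x) - chi {y | t < u y} x| ∂μ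
    with hD
  have hDm : ∀ k i, Measurable (D k i) := fun k i =>
    Measurable.lintegral_prod_right' (f := fun p : ℝ × X =>
      ENNReal.ofReal |ramp p.1 (h i) (v i p.2) - chi {y | p.1 < u y} p.2|)
      ((measurable_ramp_comp (hvm i) (h i)).sub (measurable_chi_setOf_lt hu)).abs.ennreal_ofReal
  have hDlim : ∀ k, Tendsto (fun i => ∫⁻ t, D k i t) atTop (𝓝 0) := by
    intro k
    have hU := compactlyInside_exhaustion Ω x₀ k
    have hfin : μ (exhaustion Ω x₀ k) ≠ ∞ :=
      ((measure_mono subset_closure).trans_lt hU.2.1.measure_lt_top).ne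
    have hh0 : Tendsto (fun i => ENNReal.ofReal (h i)) atTop (𝓝 0) := by
      simpa [hdef] using ENNReal.tendsto_ofReal tendsto_one_div_add_atTop_nhds_zero_nat
    have hlim := (h3 _ hU).add (ENNReal.Tendsto.mul_const hh0 (Or.inr hfin))
    rw [zero_mul, add_zero] at hlim
    exact tendsto_of_tendsto_of_tendsto_of_le_of_le tendsto_const_nhds hlim (fun _ => zero_le)
      fun i => lintegral_lintegral_ramp_sub_chi_le hu (hvm i) (hh i) _
  -- Summable errors give convergence for a.e. `t`. The indices `n k` need not increase: the
  -- gradient bound holds for every index, and only the errors have to tend to `0`.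
  have hn : ∀ k : ℕ, ∃ i, ∫⁻ t, D k i t < (2⁻¹ : ℝ≥0∞) ^ k := fun k =>
    ((hDlim k).eventually_lt_const (by simp [ENNReal.pow_pos])).exists
  choose n hn using hn
  have hae : ∀ᵐ t, Tendsto (fun k => D k (n k) t) atTop (𝓝 0) := by
    have hsum : ∫⁻ t, ∑' k, D k (n k) t ≠ ∞ := by
      rw [lintegral_tsum fun k => (hDm k (n k)).aemeasurable]
      refine ((ENNReal.tsum_le_tsum fun k => (hn k).le).trans_lt ?_).ne
      rw [ENNReal.tsum_geometric]
      simp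
    filter_upwards [ae_lt_top (Measurable.tsum fun k => hDm k (n k)) hsum] with t ht
    exact ENNReal.tendsto_atTop_zero_of_tsum_ne_top ht.ne
  set J : ℕ → ℝ → ℝ≥0∞ := fun k t => ∫⁻ x in Ω,
    (v (n k) ⁻¹' Icc t (t + h (n k))).indicator (fun x => g (n k) x / ENNReal.ofReal (h (n k))) x ∂μ
    with hJ
  have hJm : ∀ k, Measurable (J k) := fun k =>
    Measurable.lintegral_prod_right' (measurable_indicator_preimage_Icc (h2 (n k)).1 (hvm _) _)
  refine ⟨fun t => liminf (fun k => J k t) atTop, Measurable.liminf hJm, ?_, ?_⟩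
  · refine (lintegral_liminf_le hJm).trans ?_
    refine liminf_le_of_frequently_le (Frequently.of_forall fun k => ?_)
    rw [hJ]
    exact (lintegral_lintegral_indicator_preimage_Icc (h2 _).1 (hvm _) (hh _) Ω).trans_le (h4 _).le
  · filter_upwards [hae] with t ht
    refine totalVariation_le_liminf (v := fun k x => ramp t (h (n k)) (v (n k) x))
      (fun k => (h1 _).comp (ramp_lipschitz _ _))
      (fun k => (h2 _).ramp ((h1 _).continuousOn hΩ) (hvm _) (hh _)) fun V hV => ?_
    obtain ⟨k₀, hk₀⟩ := exists_subset_exhaustion hΩ x₀ hV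
    refine tendsto_of_tendsto_of_tendsto_of_le_of_le' tendsto_const_nhds ht
      (Eventually.of_forall fun _ => zero_le) ?_
    filter_upwards [eventually_ge_atTop k₀] with k hk
    exact lintegral_mono_set (hk₀.trans (exhaustion_mono Ω x₀ hk))

/-- One inequality of the coarea formula. -/
theorem exists_coarea_majorant [Nonempty X] [SFinite μ] [IsLocallyFiniteMeasure μ]
    (hΩ : IsOpen Ω) (hu : Measurable u) (hfin : totalVariation μ u Ω < ∞) :
    ∃ G : ℝ → ℝ≥0∞, Measurable G ∧ ∫⁻ t, G t ≤ totalVariation μ u Ω ∧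
      ∀ᵐ t, totalVariation μ (chi {y | t < u y}) Ω ≤ G t := by
  -- The bounds `‖Du‖(Ω) + 1 / n` are strict upper bounds, as required; for `n = 0` the bound is
  -- `∞`. The infimum of the countably many majorants is the final one.
  choose G hG1 hG2 hG3 using fun n : ℕ => exists_coarea_majorant_of_lt (μ := μ) hΩ hu
    (ENNReal.lt_add_right hfin.ne (b := ((n : ℝ≥0∞))⁻¹) (by simp))
  refine ⟨fun t => ⨅ n, G n t, Measurable.iInf hG1, ?_, ?_⟩
  · refine ge_of_tendsto' (x := atTop) (f := fun n : ℕ => totalVariation μ u Ω + (n : ℝ≥0∞)⁻¹) ?_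
      fun n => (lintegral_mono fun t => iInf_le _ n).trans (hG2 n)
    simpa using tendsto_const_nhds.add ENNReal.tendsto_inv_nat_nhds_zero
  · filter_upwards [ae_all_iff.2 hG3] with t ht
    exact le_iInf ht

end

end

/-! ### Absolute continuity of the perimeter with respect to the codimension one Hausdorff measure.
-/

section

theorem lipschitzWith_one_sub_ramp_dist {X : Type*} [MetricSpace X] (x : X) (r : ℝ) :
    LipschitzWith ‖r⁻¹‖₊ fun y => 1 - ramp r r (dist y x) := by
  have h := (ramp_lipschitz r r).comp (LipschitzWith.dist_left x)
  rw [mul_one] at h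
  refine LipschitzWith.of_dist_le_mul fun y z => ?_
  rw [dist_sub_left]
  exact h.dist_le_mul y z

theorem chi_nonneg {X : Type*} (E : Set X) (x : X) : 0 ≤ chi E x :=
  indicator_nonneg (fun _ _ => zero_le_one) x

theorem chi_le_one {X : Type*} (E : Set X) (x : X) : chi E x ≤ 1 :=
  indicator_le_self' (fun _ _ => zero_le_one) x

variable {X : Type*} [MetricSpace X] [MeasurableSpace X] {μ : Measure X}

/-- A ball of radius `r` has a Lipschitz cutoff function whose upper gradient and whose integral
are controlled by `μ(B) / r`. -/
theorem IsDoubling.exists_cutoff [BorelSpace X] (hμ : IsDoubling μ) :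
    ∃ K : ℝ≥0∞, K ≠ ∞ ∧ ∀ t : Finset (X × ℝ), (∀ p ∈ t, 0 < p.2 ∧ p.2 ≤ 1) →
      ∃ (η : X → ℝ) (g : X → ℝ≥0∞), (∃ L, LipschitzWith L η) ∧ (∀ x, 0 ≤ η x) ∧ (∀ x, η x ≤ 1) ∧
        (∀ p ∈ t, ∀ x ∈ Metric.ball p.1 p.2, η x = 1) ∧ IsUpperGradient g η univ ∧
        ∫⁻ x, g x ∂μ ≤ K * ∑ p ∈ t, μ (Metric.ball p.1 p.2) / ENNReal.ofReal p.2 ∧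
        ∫⁻ x, ENNReal.ofReal (η x) ∂μ ≤
          K * ∑ p ∈ t, μ (Metric.ball p.1 p.2) / ENNReal.ofReal p.2 := by
  classical
  obtain ⟨C, hC⟩ := hμ.exists_measure_ball_pow_le
  -- The cutoff of a ball of radius `r` vanishes beyond distance `2r`, hence off the open ball of
  -- radius `4r`, whose measure two doublings bound. The cutoffs are combined by taking maxima, and
  -- the estimates add up.
  refine ⟨(C : ℝ≥0∞) ^ 2, by finiteness, fun t => ?_⟩
  induction t using Finset.induction_on with
  | empty =>
    intro _
    refine ⟨fun _ => 0, fun _ => 0, ⟨0, LipschitzWith.const 0⟩, by simp, by simp, by simp,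
      ⟨measurable_const, fun l γ _ _ _ => by simp⟩, by simp, by simp⟩
  | insert p t hp ih =>
    intro ht
    obtain ⟨η, g, ⟨L, hL⟩, h0, h1, hball, hg, hgi, hηi⟩ :=
      ih fun q hq => ht q (Finset.mem_insert_of_mem hq)
    obtain ⟨hr0, hr1⟩ := ht p (Finset.mem_insert_self _ _)
    have hr0' : ENNReal.ofReal p.2 ≠ 0 := (ENNReal.ofReal_pos.2 hr0).ne'
    set ζ : X → ℝ := fun y => 1 - ramp p.2 p.2 (dist y p.1) with hζ
    have hζL := lipschitzWith_one_sub_ramp_dist p.1 p.2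
    have hdist : Measurable fun y => dist y p.1 :=
      (continuous_id.dist continuous_const).measurable
    have hζg : IsUpperGradient (((fun y => dist y p.1) ⁻¹' Icc p.2 (p.2 + p.2)).indicator
        fun _ => 1 / ENNReal.ofReal p.2) ζ univ :=
      ((isUpperGradient_dist p.1).ramp
        (continuous_id.dist continuous_const).continuousOn hdist hr0).of_abs_sub_le
        fun x _ y _ => by rw [hζ, sub_sub_sub_cancel_left, abs_sub_comm]
    have hsub : ∀ y, dist y p.1 ≤ p.2 + p.2 → y ∈ Metric.ball p.1 (2 ^ 2 * p.2) := fun y hy => by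
      rw [Metric.mem_ball]
      linarith
    have hvol := hC 2 p.1 p.2 hr0
    -- Since `r ≤ 1`, the sum that controls the gradient controls the integral of `η` as well.
    have hle : μ (Metric.ball p.1 p.2) ≤ μ (Metric.ball p.1 p.2) / ENNReal.ofReal p.2 := by
      rw [ENNReal.le_div_iff_mul_le (Or.inl hr0') (Or.inl ENNReal.ofReal_ne_top)]
      exact mul_le_of_le_one_right' (ENNReal.ofReal_le_one.2 hr1)
    refine ⟨fun x => max (η x) (ζ x), _, ⟨_, hL.max hζL⟩, fun x => (h0 x).trans (le_max_left _ _),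
      fun x => max_le (h1 x) (sub_le_self _ (ramp_nonneg _ _ _)), fun q hq x hx => ?_, hg.max hζg,
      ?_, ?_⟩
    · rcases Finset.mem_insert.1 hq with rfl | hq
      · have : ζ x = 1 := by
          rw [hζ]
          simp only
          rw [ramp_eq_zero hr0 (Metric.mem_ball.1 hx).le, sub_zero]
        simp only [this]
        exact max_eq_right (h1 x)
      · simp only [hball q hq x hx]
        exact max_eq_left (sub_le_self _ (ramp_nonneg _ _ _))
    · rw [lintegral_add_left hg.1, Finset.sum_insert hp, mul_add, add_comm]
      refine add_le_add ?_ hgi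
      rw [lintegral_indicator (hdist measurableSet_Icc), setLIntegral_const, one_div,
        mul_comm, ← div_eq_mul_inv, ← mul_div_assoc]
      gcongr
      exact (measure_mono fun y hy => hsub y hy.2).trans hvol
    · rw [Finset.sum_insert hp, mul_add, add_comm]
      calc ∫⁻ x, ENNReal.ofReal (max (η x) (ζ x)) ∂μ
          ≤ ∫⁻ x, (ENNReal.ofReal (η x) +
              (Metric.ball p.1 (2 ^ 2 * p.2)).indicator (fun _ => 1) x) ∂μ := by
            refine lintegral_mono fun x => ?_
            by_cases hx : dist x p.1 ≤ p.2 + p.2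
            · rw [indicator_of_mem (hsub x hx)]
              refine le_add_left (ENNReal.ofReal_le_one.2 ?_)
              exact max_le (h1 x) (sub_le_self _ (ramp_nonneg _ _ _))
            · have : ζ x = 0 := by
                rw [hζ]
                simp only
                rw [ramp_eq_one hr0 (not_le.1 hx).le, sub_self]
              rw [this, max_eq_left (h0 x)]
              exact le_self_add
        _ = (∫⁻ x, ENNReal.ofReal (η x) ∂μ) + μ (Metric.ball p.1 (2 ^ 2 * p.2)) := by
            rw [lintegral_add_left hL.continuous.measurable.ennreal_ofReal,
              lintegral_indicator Metric.isOpen_ball.measurableSet, setLIntegral_const, one_mul]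
        _ ≤ _ := add_le_add hηi (hvol.trans (mul_le_mul_right hle _))

theorem variation_le_totalVariation {u : X → ℝ} {A U : Set X} (hU : IsOpen U) (h : A ⊆ U) :
    variation μ u A ≤ totalVariation μ u U :=
  iInf_le_of_le U <| iInf_le_of_le hU <| iInf_le_of_le h le_rfl

theorem codimOneContent_le_codimOneHausdorff {R : ℝ} (hR : 0 < R) (A : Set X) :
    codimOneContent μ R A ≤ codimOneHausdorff μ A :=
  le_iSup₂_of_le R hR le_rfl

theorem codimOneHausdorff_mono {A B : Set X} (h : A ⊆ B) :
    codimOneHausdorff μ A ≤ codimOneHausdorff μ B :=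
  iSup₂_mono fun _ _ => le_iInf fun s => le_iInf fun h1 => le_iInf fun h2 => le_iInf fun h3 =>
    iInf_le_of_le s <| iInf_le_of_le h1 <| iInf_le_of_le h2 <| iInf_le_of_le (h.trans h3) le_rfl

theorem exists_cover_of_codimOneHausdorff_eq_zero {A : Set X} (hA : codimOneHausdorff μ A = 0)
    {R : ℝ} (hR : 0 < R) {ε : ℝ≥0∞} (hε : 0 < ε) :
    ∃ s : Set (X × ℝ), s.Countable ∧ (∀ p ∈ s, 0 < p.2 ∧ p.2 ≤ R) ∧
      A ⊆ ⋃ p ∈ s, Metric.ball p.1 p.2 ∧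
      ∑' p : s, μ (Metric.ball p.1.1 p.1.2) / ENNReal.ofReal p.1.2 < ε := by
  have h := ((codimOneContent_le_codimOneHausdorff (μ := μ) hR A).trans hA.le).trans_lt hε
  simp only [codimOneContent, iInf_lt_iff] at h
  obtain ⟨s, h1, h2, h3, h4⟩ := h
  exact ⟨s, h1, h2, h3, h4⟩

/-- Finiteness and null sets of the perimeter measure require only this upper bound, not equality
with the set function. -/
theorem perimeterMeasure_le_variation [BorelSpace X] {E A : Set X} (hA : MeasurableSet A) :
    perimeterMeasure μ E A ≤ variation μ (chi E) A := by
  rw [perimeterMeasure, variationMeasure, toMeasure_apply _ _ hA]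
  exact OuterMeasure.ofFunction_le A

theorem isFiniteMeasure_perimeterMeasure [BorelSpace X] {E : Set X}
    (hfin : totalVariation μ (chi E) univ < ∞) :
    IsFiniteMeasure (perimeterMeasure μ E) :=
  ⟨((perimeterMeasure_le_variation MeasurableSet.univ).trans
    (variation_le_totalVariation isOpen_univ subset_rfl)).trans_lt hfin⟩

section

variable [BorelSpace X] [ProperSpace X] {E K : Set X}

/-- A competitor for `χ_E` that does not see the variation on `K`. -/
theorem IsDoubling.exists_approx_of_codimOneHausdorff_eq_zero (hμ : IsDoubling μ)
    (hfin : totalVariation μ (chi E) univ < ∞) (hE : Measurable (chi E)) (hK : IsCompact K)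
    (h0 : codimOneHausdorff μ K = 0) {δ ε : ℝ≥0∞} (hδ : δ < variation μ (chi E) K) (hε : 0 < ε) :
    ∃ w : X → ℝ, Measurable w ∧ totalVariation μ w univ + δ ≤
      totalVariation μ (chi E) univ + (ε + ε) ∧ ∫⁻ x, ENNReal.ofReal |w x - chi E x| ∂μ ≤ ε := by
  classical
  set m := totalVariation μ (chi E) univ with hm
  rcases eq_or_ne ε ∞ with rfl | hε'
  · exact ⟨chi E, hE, by simp, by simp⟩
  obtain ⟨C, hC, hcut⟩ := hμ.exists_cutoff
  obtain ⟨s, -, hsr, hKs, hsum⟩ := exists_cover_of_codimOneHausdorff_eq_zero h0 one_pos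
    (ENNReal.div_pos hε.ne' hC)
  obtain ⟨b, hbs, hbf, hKb⟩ := hK.elim_finite_subcover_image
    (fun p _ => Metric.isOpen_ball (x := p.1) (ε := p.2)) hKs
  lift b to Finset (X × ℝ) using hbf
  obtain ⟨η, gη, ⟨L, hL⟩, hη0, hη1, hηb, hgη, hgi, hηi⟩ := hcut b fun p hp => hsr p (hbs hp)
  have hsmall : C * ∑ p ∈ b, μ (Metric.ball p.1 p.2) / ENNReal.ofReal p.2 ≤ ε := by
    have h1 : ∑ p ∈ b, μ (Metric.ball p.1 p.2) / ENNReal.ofReal p.2 ≤ ε / C := by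
      refine le_trans ?_ hsum.le
      rw [tsum_subtype s fun p : X × ℝ => μ (Metric.ball p.1 p.2) / ENNReal.ofReal p.2]
      refine le_trans (le_of_eq (Finset.sum_congr rfl fun p hp => ?_)) (ENNReal.sum_le_tsum b)
      rw [indicator_of_mem (hbs hp)]
    exact (mul_le_mul_right h1 C).trans ENNReal.mul_div_le
  set O : Set X := ⋃ p ∈ (b : Set (X × ℝ)), Metric.ball p.1 p.2 with hO
  have hOo : IsOpen O := isOpen_biUnion fun _ _ => Metric.isOpen_ball
  have hOη : ∀ x ∈ O, η x = 1 := fun x hx => by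
    obtain ⟨p, hp, hx⟩ := mem_iUnion₂.1 hx
    exact hηb p hp x hx
  obtain ⟨v, g, h1, hvm, h2, h3, h4⟩ := exists_seq_of_totalVariation_lt isOpen_univ
    (ENNReal.lt_add_right hfin.ne hε.ne')
  have hδm : δ ≤ m := hδ.le.trans (variation_le_totalVariation isOpen_univ (subset_univ K))
  refine ⟨fun x => max (chi E x) (η x), hE.max hL.continuous.measurable, ?_, ?_⟩
  · have hTV : totalVariation μ (fun x => max (chi E x) (η x)) univ ≤ (m + ε - δ) + ε := by
      -- Truncation at `1` is harmless because `χ_E ≤ 1`, and it allows `g i` to be dropped where `η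
      -- = 1`.
      have hv1 : ∀ i, IsUpperGradient (g i) (fun x => min (v i x) 1) univ := fun i =>
        (h2 i).of_abs_sub_le fun x _ y _ => by
          simpa using abs_min_sub_min_le_max (v i x) 1 (v i y) 1
      refine totalVariation_le_of_frequently_le (v := fun i x => max (min (v i x) 1) (η x))
        (fun i U hU => ?_)
        (fun i => (hv1 i).max_of_le_one hgη (fun x _ => min_le_right _ _) hL.continuous)
        (fun U hU => ?_) (Eventually.frequently ?_)
      · obtain ⟨k, hk⟩ := h1 i U hU
        refine ⟨max k L, LipschitzOnWith.of_dist_le_mul fun x hx y hy => ?_⟩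
        have e1 := hk.dist_le_mul x hx y hy
        have e2 := hL.dist_le_mul x y
        rw [Real.dist_eq] at e1 e2 ⊢
        refine (abs_max_sub_max_le_max _ _ _ _).trans (max_le ?_ ?_)
        · have e3 := abs_min_sub_min_le_max (v i x) 1 (v i y) 1
          rw [sub_self, abs_zero, max_eq_left (abs_nonneg _)] at e3
          refine (e3.trans e1).trans ?_
          gcongr
          exact le_max_left _ _
        · refine e2.trans ?_
          gcongr
          exact le_max_right _ _
      · refine tendsto_of_tendsto_of_tendsto_of_le_of_le tendsto_const_nhds (h3 U hU)
          (fun _ => zero_le) fun i => lintegral_mono fun x => ENNReal.ofReal_le_ofReal ?_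
        refine (abs_max_sub_max_le_max _ _ _ _).trans ?_
        rw [sub_self, abs_zero, max_eq_left (abs_nonneg _)]
        have e3 := abs_min_sub_min_le_max (v i x) 1 (chi E x) 1
        rwa [sub_self, abs_zero, max_eq_left (abs_nonneg _), min_eq_left (chi_le_one E x)] at e3
      -- The open set `O` contains `K`, so eventually more than `δ` of the integral of `g i` lies in
      -- `O`. There `η = 1`, and this amount is saved; the cutoff costs at most `ε`.
      · have hOlim : δ < liminf (fun i => ∫⁻ x in O, g i x ∂μ) atTop :=
          (hδ.trans_le (variation_le_totalVariation hOo hKb)).trans_le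
            (totalVariation_le_liminf (fun i => (h1 i).mono (subset_univ _))
              (fun i => (h2 i).mono (subset_univ _))
              fun U hU => h3 U ⟨hU.1, hU.2.1, subset_univ _⟩)
        filter_upwards [eventually_lt_of_lt_liminf hOlim] with i hi
        have hFm : MeasurableSet {x | η x ≠ 1} :=
          (isClosed_eq hL.continuous continuous_const).measurableSet.compl
        rw [Measure.restrict_univ, lintegral_add_left ((h2 i).1.indicator hFm),
          lintegral_indicator hFm]
        refine add_le_add (ENNReal.le_sub_of_add_le_right (hδm.trans_lt hfin).ne ?_)
          (hgi.trans hsmall)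
        refine (add_le_add_right hi.le _).trans ?_
        have hdisj : Disjoint {x | η x ≠ 1} O :=
          Set.disjoint_left.2 fun x hx hx' => hx (hOη x hx')
        rw [← lintegral_union hOo.measurableSet hdisj]
        refine (lintegral_mono_set (subset_univ _)).trans (h4 i).le
    calc _ ≤ (m + ε - δ) + ε + δ := add_le_add_left hTV δ
      _ = (m + ε - δ + δ) + ε := add_right_comm _ _ _
      _ = m + (ε + ε) := by rw [tsub_add_cancel_of_le (hδm.trans le_self_add), add_assoc]
  · refine (lintegral_mono fun x => ENNReal.ofReal_le_ofReal ?_).trans (hηi.trans hsmall)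
    have e0 := chi_nonneg E x
    rw [abs_of_nonneg (sub_nonneg.2 (le_max_left _ _)), sub_le_iff_le_add]
    exact max_le (by linarith [hη0 x]) (by linarith)

/-- Otherwise there are competitors that converge to `χ_E` in `L¹` while their variation stays below
that of `χ_E` by a fixed amount, against lower semicontinuity. -/
theorem IsDoubling.variation_eq_zero_of_isCompact [Nonempty X] (hμ : IsDoubling μ)
    (hfin : totalVariation μ (chi E) univ < ∞) (hE : Measurable (chi E)) (hK : IsCompact K)
    (h0 : codimOneHausdorff μ K = 0) : variation μ (chi E) K = 0 := by
  by_contra hne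
  obtain ⟨δ, hδ0, hδ⟩ := exists_between (pos_iff_ne_zero.2 hne)
  set m := totalVariation μ (chi E) univ with hm
  have hδm : δ ≤ m := hδ.le.trans (variation_le_totalVariation isOpen_univ (subset_univ K))
  have hδt : δ ≠ ∞ := (hδm.trans_lt hfin).ne
  -- With `m - δ < c < m` there is room for `m + 2ε < c + δ`, so every competitor has variation less
  -- than `c`.
  obtain ⟨c, hc1, hc2⟩ := exists_between
    (ENNReal.sub_lt_self hfin.ne (hδ0.trans_le hδm).ne' hδ0.ne')
  have hmc : m < c + δ := (ENNReal.sub_lt_iff_lt_right hδt hδm).1 hc1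
  obtain ⟨ε, hε, hεm⟩ : ∃ ε : ℝ≥0∞, 0 < ε ∧ m + (ε + ε) < c + δ := by
    obtain ⟨ε, hε, h⟩ := ENNReal.lt_iff_exists_add_pos_lt.1 hmc
    refine ⟨((ε / 2 : ℝ≥0) : ℝ≥0∞), by simpa using hε.ne', ?_⟩
    rwa [← ENNReal.coe_add, add_halves]
  choose w hwm hw hwi using fun n : ℕ => hμ.exists_approx_of_codimOneHausdorff_eq_zero hfin hE hK h0
    hδ (ε := min ε ((n : ℝ≥0∞)⁻¹)) (lt_min hε (by simp))
  have hle : m ≤ c := by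
    refine totalVariation_le_of_tendsto isOpen_univ (fun n => (hwm n).aemeasurable) (fun n => ?_)
      (w := w) fun U hU => ?_
    · have : totalVariation μ (w n) univ + δ < c + δ :=
        ((hw n).trans (by gcongr <;> exact min_le_left _ _)).trans_lt hεm
      exact lt_of_add_lt_add_right this
    · refine tendsto_of_tendsto_of_tendsto_of_le_of_le tendsto_const_nhds
        ENNReal.tendsto_inv_nat_nhds_zero (fun _ => zero_le) fun n => ?_
      exact ((lintegral_mono' Measure.restrict_le_self le_rfl).trans (hwi n)).trans (min_le_right _ _)
  exact absurd hle (not_le.2 hc2)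

/-- The perimeter measure is absolutely continuous with respect to the codimension one Hausdorff
measure. -/
theorem IsDoubling.perimeterMeasure_eq_zero [Nonempty X] (hμ : IsDoubling μ)
    (hfin : totalVariation μ (chi E) univ < ∞) (hE : Measurable (chi E)) {A : Set X}
    (hA : codimOneHausdorff μ A = 0) : perimeterMeasure μ E A = 0 := by
  have := isFiniteMeasure_perimeterMeasure hfin
  have hpos : ∀ n : ℕ, (0 : ℝ) < 1 / ((n : ℝ) + 1) := fun n => by positivity
  choose s hsc hsr hAs hsum using fun n : ℕ => exists_cover_of_codimOneHausdorff_eq_zero hA (hpos n)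
    (ε := (n : ℝ≥0∞)⁻¹) (by simp)
  -- A Borel set containing `A` that is still null for `ℋ`, since each of the covers of `A` covers
  -- it. Inner regularity of the finite perimeter measure then reduces the claim to compact sets.
  set B : Set X := ⋂ n, ⋃ p ∈ s n, Metric.ball p.1 p.2 with hB
  have hBm : MeasurableSet B := MeasurableSet.iInter fun n =>
    (isOpen_biUnion fun _ _ => Metric.isOpen_ball).measurableSet
  have hB0 : codimOneHausdorff μ B = 0 := by
    refine le_antisymm (iSup₂_le fun R hR => ?_) zero_le
    refine ge_of_tendsto ENNReal.tendsto_inv_nat_nhds_zero ?_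
    filter_upwards [tendsto_one_div_add_atTop_nhds_zero_nat.eventually_le_const hR] with n hn
    exact iInf_le_of_le (s n) <| iInf_le_of_le (hsc n) <|
      iInf_le_of_le (fun p hp => ⟨(hsr n p hp).1, (hsr n p hp).2.trans hn⟩) <|
      iInf_le_of_le (iInter_subset _ n) (hsum n).le
  refine measure_mono_null (subset_iInter hAs) ?_
  rw [hBm.measure_eq_iSup_isCompact_of_ne_top (measure_ne_top _ _)]
  simp only [ENNReal.iSup_eq_zero]
  intro K hKB hK
  exact le_antisymm ((perimeterMeasure_le_variation hK.measurableSet).trans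
    (hμ.variation_eq_zero_of_isCompact hfin hE hK
      (le_antisymm ((codimOneHausdorff_mono hKB).trans hB0.le) zero_le)).le) zero_le

end

end

/-! ### The measure theoretic boundary, traces as limits of averages, and Cavalieri's principle. -/

section

variable {X : Type*} [MetricSpace X] [MeasurableSpace X] {μ : Measure X} {Ω : Set X}
  {u v : X → ℝ} {x : X} {τ σ : ℝ}

theorem limsup_pos_iff_not_tendsto {α : Type*} {l : Filter α} [l.NeBot] (F : α → ℝ≥0∞) :
    0 < limsup F l ↔ ¬ Tendsto F l (𝓝 0) := by
  rw [pos_iff_ne_zero, not_iff_not]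
  exact ⟨fun h => tendsto_of_le_liminf_of_limsup_le zero_le h.le, fun h => h.limsup_eq⟩

/-- By doubling, densities can be computed along a geometric sequence of radii. -/
theorem IsDoubling.tendsto_density_iff (hμ : IsDoubling μ) (x : X) (E : Set X) :
    Tendsto (fun r : ℝ => μ (Metric.ball x r ∩ E) / μ (Metric.ball x r)) (𝓝[>] 0) (𝓝 0) ↔
      Tendsto (fun n : ℕ => μ (Metric.ball x ((1 / 2) ^ n) ∩ E) / μ (Metric.ball x ((1 / 2) ^ n)))
        atTop (𝓝 0) := by
  constructor
  · intro h
    refine h.comp (tendsto_nhdsWithin_iff.2 ⟨?_, Eventually.of_forall fun n => ?_⟩)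
    · exact tendsto_pow_atTop_nhds_zero_of_lt_one (by norm_num) (by norm_num)
    · exact pow_pos (by norm_num : (0 : ℝ) < 1 / 2) n
  · intro h
    obtain ⟨C, hC⟩ := hμ.exists_measure_ball_pow_le
    have h' := ENNReal.Tendsto.const_mul h (Or.inr (ENNReal.coe_ne_top (r := C)))
    rw [mul_zero] at h'
    refine ENNReal.tendsto_nhds_zero.2 fun ε hε => ?_
    obtain ⟨N, hN⟩ := eventually_atTop.1 (ENNReal.tendsto_nhds_zero.1 h' ε hε)
    have hpos : (0 : ℝ) < (1 / 2) ^ N := by positivity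
    filter_upwards [Ioo_mem_nhdsGT hpos] with r hr
    -- For `2⁻ⁿ⁻¹ < r ≤ 2⁻ⁿ` the density at radius `r` is at most `C` times the one at radius `2⁻ⁿ`.
    obtain ⟨n, hn1, hn2⟩ := exists_nat_pow_near_of_lt_one hr.1
      (hr.2.le.trans (pow_le_one₀ (by norm_num) (by norm_num)))
      (by norm_num : (0 : ℝ) < 1 / 2) (by norm_num : (1 / 2 : ℝ) < 1)
    have hNn : N ≤ n := by
      have h1 : (1 / 2 : ℝ) ^ (n + 1) < (1 / 2) ^ N := hn1.trans hr.2
      have h2 := (pow_lt_pow_iff_right_of_lt_one₀ (by norm_num : (0 : ℝ) < 1 / 2)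
        (by norm_num)).1 h1
      omega
    refine le_trans ?_ (hN n hNn)
    have hball : μ (Metric.ball x ((1 / 2) ^ n)) ≤ C * μ (Metric.ball x r) := by
      have h1 := hC 1 x ((1 / 2) ^ (n + 1)) (by positivity)
      rw [pow_one, pow_one, pow_succ' (1 / 2 : ℝ), ← mul_assoc, mul_one_div_cancel two_ne_zero,
        one_mul, ← pow_succ'] at h1
      exact h1.trans (mul_le_mul_right (measure_mono (Metric.ball_subset_ball hn1.le)) _)
    have hb0 := (hμ.measure_ball_pos x hr.1).ne'
    have hbt := (hμ.measure_ball_lt_top x r).ne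
    have hn0 := (hμ.measure_ball_pos x (pow_pos (by norm_num : (0 : ℝ) < 1 / 2) n)).ne'
    have hnt := (hμ.measure_ball_lt_top x ((1 / 2) ^ n)).ne
    have hinv : (μ (Metric.ball x r))⁻¹ ≤ C * (μ (Metric.ball x ((1 / 2) ^ n)))⁻¹ := by
      rw [← one_div, ENNReal.div_le_iff hb0 hbt, mul_right_comm, ← div_eq_mul_inv,
        ← ENNReal.div_self hn0 hnt]
      exact ENNReal.div_le_div_right hball _
    rw [div_eq_mul_inv, div_eq_mul_inv, mul_left_comm]
    exact mul_le_mul' (measure_mono (inter_subset_inter_left _ (Metric.ball_subset_ball hn2))) hinv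

theorem measurable_measure_ball_inter [BorelSpace X] [SecondCountableTopology X] [SFinite μ]
    (r : ℝ) (E : Set X) : Measurable fun x => μ (Metric.ball x r ∩ E) := by
  have h : MeasurableSet {p : X × X | dist p.2 p.1 < r} :=
    measurableSet_lt (measurable_snd.dist measurable_fst) measurable_const
  have heq : (fun x => μ (Metric.ball x r ∩ E)) =
      fun x => μ.restrict E (Prod.mk x ⁻¹' {p : X × X | dist p.2 p.1 < r}) := by
    ext x
    exact (Measure.restrict_apply Metric.isOpen_ball.measurableSet).symm
  rw [heq]
  exact measurable_measure_prodMk_left h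

/-- With the densities taken along a sequence of radii, only countably many measurable functions of
`x` are involved. -/
theorem IsDoubling.measurableSet_measureBoundary [BorelSpace X] [SecondCountableTopology X]
    [SFinite μ] (hμ : IsDoubling μ) (E : Set X) : MeasurableSet (measureBoundary μ E) := by
  have key : ∀ F : Set X, MeasurableSet {x | 0 < limsup (fun r : ℝ =>
      μ (Metric.ball x r ∩ F) / μ (Metric.ball x r)) (𝓝[>] 0)} := by
    intro F
    simp only [limsup_pos_iff_not_tendsto, hμ.tendsto_density_iff]
    refine (measurableSet_tendsto (𝓝 0) fun n => ?_).compl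
    refine (measurable_measure_ball_inter _ F).div ?_
    simpa using measurable_measure_ball_inter (μ := μ) ((1 / 2) ^ n) univ
  simp only [measureBoundary, sdiff_eq]
  exact (key E).inter (key Eᶜ)

/-- Averages over `ball x r ∩ Ω` are therefore genuine at boundary points, which makes traces unique
there. -/
theorem measure_ball_inter_pos_of_mem_measureBoundary (hx : x ∈ measureBoundary μ Ω) {r : ℝ}
    (hr : 0 < r) : 0 < μ (Metric.ball x r ∩ Ω) := by
  by_contra h
  refine (limsup_pos_iff_not_tendsto _).1 hx.1 (tendsto_const_nhds.congr' ?_)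
  filter_upwards [Ioo_mem_nhdsGT hr] with s hs
  have : μ (Metric.ball x s ∩ Ω) = 0 := measure_mono_null
    (inter_subset_inter_left _ (Metric.ball_subset_ball hs.2.le)) (nonpos_iff_eq_zero.1 (not_lt.1 h))
  rw [this, ENNReal.zero_div]

theorem isTrace_congr_ae (h : u =ᵐ[μ.restrict Ω] v) : IsTrace μ Ω u = IsTrace μ Ω v := by
  have : ∀ (x : X) (τ r : ℝ), ⨍⁻ y in Metric.ball x r ∩ Ω, ENNReal.ofReal |u y - τ| ∂μ =
      ⨍⁻ y in Metric.ball x r ∩ Ω, ENNReal.ofReal |v y - τ| ∂μ := fun x τ r => by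
    refine laverage_congr ?_
    filter_upwards [ae_restrict_of_ae_restrict_of_subset inter_subset_right h] with y hy
    rw [hy]
  ext x τ
  simp only [IsTrace, this]

theorem trace_congr_ae (h : u =ᵐ[μ.restrict Ω] v) : trace μ Ω u = trace μ Ω v := by
  unfold trace
  rw [isTrace_congr_ae h]

theorem isTrace_trace (h : ∃ τ, IsTrace μ Ω u x τ) : IsTrace μ Ω u x (trace μ Ω u x) := by
  rw [trace, dif_pos h]
  exact h.choose_spec

theorem laverage_add_left' {α : Type*} [MeasurableSpace α] {μ : Measure α} {f : α → ℝ≥0∞}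
    (hf : AEMeasurable f μ) (g : α → ℝ≥0∞) :
    ⨍⁻ x, (f x + g x) ∂μ = ⨍⁻ x, f x ∂μ + ⨍⁻ x, g x ∂μ := by
  simp only [laverage]
  exact lintegral_add_left' (hf.smul_measure _) g

theorem laverage_mono {α : Type*} [MeasurableSpace α] {μ : Measure α} {f g : α → ℝ≥0∞}
    (h : ∀ x, f x ≤ g x) : ⨍⁻ x, f x ∂μ ≤ ⨍⁻ x, g x ∂μ :=
  lintegral_mono h

theorem IsTrace.of_abs_sub_le_add {w : X → ℝ} {ω : ℝ} (hu : IsTrace μ Ω u x τ)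
    (hv : IsTrace μ Ω v x σ) (hum : Measurable u)
    (h : ∀ y, |w y - ω| ≤ |u y - τ| + |v y - σ|) : IsTrace μ Ω w x ω := by
  have hlim := hu.add hv
  rw [add_zero] at hlim
  refine tendsto_of_tendsto_of_tendsto_of_le_of_le tendsto_const_nhds hlim (fun _ => zero_le)
    fun r => ?_
  have hm : AEMeasurable (fun y => ENNReal.ofReal |u y - τ|)
      (μ.restrict (Metric.ball x r ∩ Ω)) := (hum.sub_const τ).abs.ennreal_ofReal.aemeasurable
  refine le_trans (laverage_mono fun y => ?_) (laverage_add_left' hm _).le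
  rw [← ENNReal.ofReal_add (abs_nonneg _) (abs_nonneg _)]
  exact ENNReal.ofReal_le_ofReal (h y)

theorem IsTrace.sub (hu : IsTrace μ Ω u x τ) (hv : IsTrace μ Ω v x σ) (hum : Measurable u) :
    IsTrace μ Ω (fun y => u y - v y) x (τ - σ) :=
  hu.of_abs_sub_le_add hv hum fun y => by
    rw [sub_sub_sub_comm]
    exact abs_sub _ _

theorem IsTrace.of_abs_sub_le {w : X → ℝ} {ω : ℝ} (hu : IsTrace μ Ω u x τ)
    (h : ∀ y, |w y - ω| ≤ |u y - τ|) : IsTrace μ Ω w x ω :=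
  tendsto_of_tendsto_of_tendsto_of_le_of_le tendsto_const_nhds hu (fun _ => zero_le)
    fun _ => laverage_mono fun y => ENNReal.ofReal_le_ofReal (h y)

/-- At a point with a trace, the averages converge to the trace. -/
theorem IsTrace.tendsto_average (hμ : IsDoubling μ) (hx : ∀ r : ℝ, 0 < r → 0 < μ (Metric.ball x r ∩ Ω))
    (hum : Measurable u) (hub : ∀ y, |u y| ≤ 1) (hu : IsTrace μ Ω u x τ) :
    Tendsto (fun r : ℝ => ⨍ y in Metric.ball x r ∩ Ω, u y ∂μ) (𝓝[>] 0) (𝓝 τ) := by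
  rw [tendsto_iff_edist_tendsto_0]
  refine tendsto_of_tendsto_of_tendsto_of_le_of_le' tendsto_const_nhds hu
    (Eventually.of_forall fun _ => zero_le) ?_
  filter_upwards [self_mem_nhdsWithin] with r hr
  set B := Metric.ball x r ∩ Ω
  have hB0 : μ B ≠ 0 := (hx r hr).ne'
  have hBt : μ B ≠ ∞ := ((measure_mono inter_subset_left).trans_lt (hμ.measure_ball_lt_top x r)).ne
  have : IsFiniteMeasure (μ.restrict B) := isFiniteMeasure_restrict.2 hBt
  have : NeZero (μ.restrict B) := ⟨by rwa [Ne, Measure.restrict_eq_zero]⟩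
  have hint : Integrable u (((μ.restrict B) univ)⁻¹ • μ.restrict B) :=
    Integrable.of_bound hum.aestronglyMeasurable 1 (Eventually.of_forall hub)
  have hsub : (⨍ y in B, u y ∂μ) - τ = ⨍ y in B, (u y - τ) ∂μ := by
    have h1 : ⨍ _ in B, τ ∂μ = τ := average_const _ _
    conv_lhs => rw [← h1]
    simp only [average]
    exact (integral_sub hint (integrable_const τ)).symm
  rw [edist_eq_enorm_sub, hsub]
  refine (enorm_integral_le_lintegral_enorm _).trans (le_of_eq ?_)
  refine lintegral_congr fun y => ?_
  rw [Real.enorm_eq_ofReal_abs]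

theorem IsTrace.unique (hμ : IsDoubling μ) (hx : ∀ r : ℝ, 0 < r → 0 < μ (Metric.ball x r ∩ Ω))
    (hum : Measurable u) (hub : ∀ y, |u y| ≤ 1) (hu : IsTrace μ Ω u x τ)
    (hu' : IsTrace μ Ω u x σ) : τ = σ :=
  tendsto_nhds_unique (hu.tendsto_average hμ hx hum hub) (hu'.tendsto_average hμ hx hum hub)

theorem IsTrace.trace_eq (hμ : IsDoubling μ) (hx : ∀ r : ℝ, 0 < r → 0 < μ (Metric.ball x r ∩ Ω))
    (hum : Measurable u) (hub : ∀ y, |u y| ≤ 1) (hu : IsTrace μ Ω u x τ) : trace μ Ω u x = τ :=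
  (isTrace_trace ⟨τ, hu⟩).unique hμ hx hum hub hu

theorem abs_average_le {α : Type*} [MeasurableSpace α] {μ : Measure α} [IsFiniteMeasure μ]
    {f : α → ℝ} (hf : ∀ y, |f y| ≤ 1) : |⨍ y, f y ∂μ| ≤ 1 := by
  rcases eq_or_ne μ 0 with rfl | h
  · simp
  have : NeZero μ := ⟨h⟩
  have h := norm_integral_le_of_norm_le_const (μ := (μ univ)⁻¹ • μ) (f := f) (C := 1)
    (Eventually.of_forall hf)
  rw [probReal_univ, mul_one] at h
  exact h

/-- The parameter in `β` will be the level `t`; joint measurability is needed for Fubini's theorem.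
-/
theorem measurable_setAverage_ball_inter [BorelSpace X] [SecondCountableTopology X] [SFinite μ]
    (hΩ : MeasurableSet Ω) {β : Type*} [MeasurableSpace β] {U : β × X → ℝ} (hU : Measurable U)
    (r : ℝ) : Measurable fun p : β × X => ⨍ y in Metric.ball p.2 r ∩ Ω, U (p.1, y) ∂μ := by
  simp only [setAverage_eq, smul_eq_mul, measureReal_def]
  refine (((measurable_measure_ball_inter r Ω).comp measurable_snd).ennreal_toReal.inv).mul ?_
  have hD : MeasurableSet {q : (β × X) × X | dist q.2 q.1.2 < r ∧ q.2 ∈ Ω} :=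
    (measurableSet_lt (measurable_snd.dist (measurable_snd.comp measurable_fst))
      measurable_const).inter (measurable_snd hΩ)
  have hm : Measurable ({q : (β × X) × X | dist q.2 q.1.2 < r ∧ q.2 ∈ Ω}.indicator
      fun q => U (q.1.1, q.2)) :=
    (hU.comp ((measurable_fst.comp measurable_fst).prodMk measurable_snd)).indicator hD
  convert (hm.stronglyMeasurable.integral_prod_right' (ν := μ)).measurable using 1
  ext p
  rw [← integral_indicator (Metric.isOpen_ball.measurableSet.inter hΩ)]
  refine integral_congr_ae (Eventually.of_forall fun y => ?_)
  by_cases hy : y ∈ Metric.ball p.2 r ∩ Ω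
  · simp only [indicator_of_mem hy]
    rw [indicator_of_mem (show (p, y) ∈ {q : (β × X) × X | dist q.2 q.1.2 < r ∧ q.2 ∈ Ω} from hy)]
  · simp only [indicator_of_notMem hy]
    rw [indicator_of_notMem
      (show (p, y) ∉ {q : (β × X) × X | dist q.2 q.1.2 < r ∧ q.2 ∈ Ω} from hy)]

theorem tendsto_one_div_nhdsGT :
    Tendsto (fun n : ℕ => 1 / ((n : ℝ) + 1)) atTop (𝓝[>] 0) :=
  tendsto_nhdsWithin_iff.2 ⟨tendsto_one_div_add_atTop_nhds_zero_nat,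
    Eventually.of_forall fun n => by
      have : (0 : ℝ) < 1 / ((n : ℝ) + 1) := by positivity
      exact this⟩

theorem ae_tendsto_average_trace {ρ : Measure X} (hμ : IsDoubling μ)
    (hρ : ∀ᵐ x ∂ρ, ∀ r : ℝ, 0 < r → 0 < μ (Metric.ball x r ∩ Ω))
    (hum : Measurable u) (hub : ∀ y, |u y| ≤ 1) (hu : ∀ᵐ x ∂ρ, ∃ τ, IsTrace μ Ω u x τ) :
    ∀ᵐ x ∂ρ, Tendsto (fun n : ℕ => ⨍ y in Metric.ball x (1 / ((n : ℝ) + 1)) ∩ Ω, u y ∂μ) atTop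
      (𝓝 (trace μ Ω u x)) := by
  filter_upwards [hρ, hu] with x hx hux
  exact ((isTrace_trace hux).tendsto_average hμ hx hum hub).comp tendsto_one_div_nhdsGT

theorem IsDoubling.abs_setAverage_le (hμ : IsDoubling μ) (hub : ∀ y, |u y| ≤ 1) (x : X) (r : ℝ) :
    |⨍ y in Metric.ball x r ∩ Ω, u y ∂μ| ≤ 1 := by
  have : IsFiniteMeasure (μ.restrict (Metric.ball x r ∩ Ω)) := isFiniteMeasure_restrict.2
    ((measure_mono inter_subset_left).trans_lt (hμ.measure_ball_lt_top x r)).ne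
  exact abs_average_le hub

section

variable [BorelSpace X] [SecondCountableTopology X] {ρ : Measure X} {f : X → ℝ}

theorem measurable_setAverage_ball_inter_const [SFinite μ] (hΩ : MeasurableSet Ω) (hum : Measurable u)
    (r : ℝ) : Measurable fun x => ⨍ y in Metric.ball x r ∩ Ω, u y ∂μ := by
  have h : Measurable fun p : ℝ × X => ⨍ y in Metric.ball p.2 r ∩ Ω, u y ∂μ :=
    measurable_setAverage_ball_inter (U := fun p : ℝ × X => u p.2) hΩ (hum.comp measurable_snd) r
  exact Measurable.of_uncurry_left (f := fun (_ : ℝ) x => ⨍ y in Metric.ball x r ∩ Ω, u y ∂μ)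
    (x := 0) h

theorem integrable_trace_mul [SFinite μ] (hμ : IsDoubling μ) (hΩ : MeasurableSet Ω)
    (hρ : ∀ᵐ x ∂ρ, ∀ r : ℝ, 0 < r → 0 < μ (Metric.ball x r ∩ Ω)) (hf : Integrable f ρ)
    (hum : Measurable u) (hub : ∀ y, |u y| ≤ 1) (hu : ∀ᵐ x ∂ρ, ∃ τ, IsTrace μ Ω u x τ) :
    Integrable (fun x => trace μ Ω u x * f x) ρ := by
  have hlim := ae_tendsto_average_trace hμ hρ hum hub hu
  refine hf.bdd_mul (c := 1) (aestronglyMeasurable_of_tendsto_ae atTop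
    (fun n => (measurable_setAverage_ball_inter_const hΩ hum _).aestronglyMeasurable) hlim) ?_
  filter_upwards [hlim] with x hx
  exact le_of_tendsto' hx.norm fun n => hμ.abs_setAverage_le hub _ _

theorem tendsto_integral_average_mul [SFinite μ] (hμ : IsDoubling μ) (hΩ : MeasurableSet Ω)
    (hρ : ∀ᵐ x ∂ρ, ∀ r : ℝ, 0 < r → 0 < μ (Metric.ball x r ∩ Ω)) (hf : Integrable f ρ)
    (hum : Measurable u) (hub : ∀ y, |u y| ≤ 1) (hu : ∀ᵐ x ∂ρ, ∃ τ, IsTrace μ Ω u x τ) :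
    Tendsto (fun n : ℕ => ∫ x, (⨍ y in Metric.ball x (1 / ((n : ℝ) + 1)) ∩ Ω, u y ∂μ) * f x ∂ρ) atTop
      (𝓝 (∫ x, trace μ Ω u x * f x ∂ρ)) := by
  refine tendsto_integral_of_dominated_convergence (fun x => |f x|) (fun n => ?_) hf.abs
    (fun n => Eventually.of_forall fun x => ?_) ?_
  · exact (measurable_setAverage_ball_inter_const hΩ hum _).aestronglyMeasurable.mul
      hf.aestronglyMeasurable
  · rw [norm_mul]
    exact mul_le_of_le_one_left (abs_nonneg _) (hμ.abs_setAverage_le hub _ _)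
  · filter_upwards [ae_tendsto_average_trace hμ hρ hum hub hu] with x hx
    exact hx.mul_const _

theorem abs_chi_le_one {X : Type*} (E : Set X) (x : X) : |chi E x| ≤ 1 := by
  rw [abs_of_nonneg (chi_nonneg E x)]
  exact chi_le_one E x

theorem measurable_chi_setOf_lt_const {X : Type*} [MeasurableSpace X] {u : X → ℝ}
    (hu : Measurable u) (t : ℝ) : Measurable (chi {y | t < u y}) :=
  measurable_const.indicator (measurableSet_lt measurable_const hu)

/-- Cavalieri's principle for traces. -/
theorem integral_trace_mul_eq [SFinite μ] [SFinite ρ] (hμ : IsDoubling μ) (hΩ : MeasurableSet Ω)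
    (hρ : ∀ᵐ x ∂ρ, ∀ r : ℝ, 0 < r → 0 < μ (Metric.ball x r ∩ Ω)) (hf : Integrable f ρ)
    (hum : Measurable u) (hu0 : ∀ y, 0 ≤ u y) (hu1 : ∀ y, u y ≤ 1)
    (hu : ∀ᵐ x ∂ρ, ∃ τ, IsTrace μ Ω u x τ)
    (hut : ∀ᵐ t ∂(volume.restrict (Ioo (0 : ℝ) 1)),
      ∀ᵐ x ∂ρ, ∃ τ, IsTrace μ Ω (chi {y | t < u y}) x τ) :
    IntegrableOn (fun t => ∫ x, trace μ Ω (chi {y | t < u y}) x * f x ∂ρ) (Ioo 0 1) ∧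
    ∫ t in Ioo (0 : ℝ) 1, ∫ x, trace μ Ω (chi {y | t < u y}) x * f x ∂ρ =
      ∫ x, trace μ Ω u x * f x ∂ρ := by
  -- The order of integration is exchanged for these averages at a fixed radius, and only then `n →
  -- ∞`. Joint measurability of the trace in `(t, x)` is thus never needed.
  set A : ℕ → ℝ → X → ℝ := fun n t x =>
    ⨍ y in Metric.ball x (1 / ((n : ℝ) + 1)) ∩ Ω, chi {y | t < u y} y ∂μ with hA
  have hAm : ∀ n, Measurable fun p : ℝ × X => A n p.1 p.2 := fun n =>
    measurable_setAverage_ball_inter hΩ (measurable_chi_setOf_lt hum) _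
  have hAb : ∀ n t x, |A n t x| ≤ 1 := fun n t x => hμ.abs_setAverage_le (abs_chi_le_one _) _ _
  have hint : ∀ n, Integrable (fun p : ℝ × X => A n p.1 p.2 * f p.2)
      ((volume.restrict (Ioo (0 : ℝ) 1)).prod ρ) := fun n =>
    (hf.comp_snd _).bdd_mul (c := 1) (hAm n).aestronglyMeasurable
      (Eventually.of_forall fun p => hAb n _ _)
  have hlayer : ∀ (n : ℕ) x, ⨍ y in Metric.ball x (1 / ((n : ℝ) + 1)) ∩ Ω, u y ∂μ =
      ∫ t in Ioo (0 : ℝ) 1, A n t x := by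
    intro n x
    set B := Metric.ball x (1 / ((n : ℝ) + 1)) ∩ Ω
    have hBt : μ B ≠ ∞ :=
      ((measure_mono inter_subset_left).trans_lt (hμ.measure_ball_lt_top x _)).ne
    have : IsFiniteMeasure (μ.restrict B) := isFiniteMeasure_restrict.2 hBt
    -- The layer cake formula, where the levels in `(0, 1)` suffice because `0 ≤ u ≤ 1`.
    have hpt : ∀ y, u y = ∫ t in Ioo (0 : ℝ) 1, chi {y | t < u y} y := by
      intro y
      simp only [chi_setOf_lt]
      rw [integral_indicator_const _ measurableSet_Iio, smul_eq_mul, mul_one, measureReal_def,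
        Measure.restrict_apply measurableSet_Iio, inter_comm, Ioo_inter_Iio, Real.volume_Ioo,
        min_eq_right (hu1 y), sub_zero, ENNReal.toReal_ofReal (hu0 y)]
    calc ⨍ y in B, u y ∂μ = ⨍ y in B, (∫ t in Ioo (0 : ℝ) 1, chi {y | t < u y} y) ∂μ := by
          simp only [← hpt]
      _ = _ := by
          simp only [hA, average]
          refine integral_integral_swap ?_
          refine Integrable.of_bound ((measurable_chi_setOf_lt hum).comp
            measurable_swap).aestronglyMeasurable 1 (Eventually.of_forall fun p => ?_)
          exact abs_chi_le_one _ _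
  have hcomm : ∀ n : ℕ, ∫ x, (⨍ y in Metric.ball x (1 / ((n : ℝ) + 1)) ∩ Ω, u y ∂μ) * f x ∂ρ =
      ∫ t in Ioo (0 : ℝ) 1, ∫ x, A n t x * f x ∂ρ := by
    intro n
    rw [integral_integral_swap (hint n)]
    simp only [hlayer, integral_mul_const]
  have hub : ∀ y, |u y| ≤ 1 := fun y => by
    rw [abs_of_nonneg (hu0 y)]
    exact hu1 y
  have hlim1 := tendsto_integral_average_mul hμ hΩ hρ hf hum hub hu
  simp only [hcomm] at hlim1
  have hlim2 : ∀ᵐ t ∂(volume.restrict (Ioo (0 : ℝ) 1)),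
      Tendsto (fun n => ∫ x, A n t x * f x ∂ρ) atTop
        (𝓝 (∫ x, trace μ Ω (chi {y | t < u y}) x * f x ∂ρ)) := by
    filter_upwards [hut] with t ht
    exact tendsto_integral_average_mul hμ hΩ hρ hf (measurable_chi_setOf_lt_const hum t)
      (abs_chi_le_one _) ht
  have hbound : ∀ n t, ‖∫ x, A n t x * f x ∂ρ‖ ≤ ∫ x, |f x| ∂ρ := fun n t => by
    refine norm_integral_le_of_norm_le hf.abs (Eventually.of_forall fun x => ?_)
    rw [norm_mul]
    exact mul_le_of_le_one_left (abs_nonneg _) (hAb n t x)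
  have hmeas : ∀ n, AEStronglyMeasurable (fun t => ∫ x, A n t x * f x ∂ρ)
      (volume.restrict (Ioo (0 : ℝ) 1)) := fun n => (hint n).aestronglyMeasurable.integral_prod_right'
  refine ⟨Integrable.of_bound (aestronglyMeasurable_of_tendsto_ae atTop hmeas hlim2)
    (∫ x, |f x| ∂ρ) ?_, tendsto_nhds_unique (tendsto_integral_of_dominated_convergence
      (fun _ => ∫ x, |f x| ∂ρ) hmeas (integrable_const _)
      (fun n => Eventually.of_forall (hbound n)) hlim2) hlim1⟩
  filter_upwards [hlim2] with t ht
  exact le_of_tendsto' ht.norm fun n => hbound n t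

end

end

/-! ### Level sets of `u` and the averaging inequality for the functional. -/

section

/-- Averaging `m ≤ A s + B t` over `t` gives `A s ≥ m - ∫ B ≥ ∫ A` for a.e. `s`, and a function that
is nowhere below its mean, up to a null set, equals it almost everywhere. -/
theorem ae_eq_integral_of_le_add {α : Type*} [MeasurableSpace α] {ν : Measure α}
    [IsProbabilityMeasure ν] {A B : α → ℝ} {m : ℝ} (hA : Integrable A ν) (hB : Integrable B ν)
    (hm : ∫ t, A t ∂ν + ∫ t, B t ∂ν ≤ m) (h : ∀ᵐ s ∂ν, ∀ᵐ t ∂ν, m ≤ A s + B t) :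
    ∀ᵐ s ∂ν, A s = ∫ t, A t ∂ν := by
  have hle : ∀ᵐ s ∂ν, 0 ≤ A s - ∫ t, A t ∂ν := by
    filter_upwards [h] with s hs
    have h1 : m - A s ≤ ∫ t, B t ∂ν := by
      calc m - A s = ∫ _, (m - A s) ∂ν := by simp
        _ ≤ _ := integral_mono_ae (integrable_const _) hB (by
          filter_upwards [hs] with t ht
          linarith)
    linarith
  have h0 : ∫ s, (A s - ∫ t, A t ∂ν) ∂ν = 0 := by
    rw [integral_sub hA (integrable_const _)]
    simp
  filter_upwards [(integral_eq_zero_iff_of_nonneg_ae hle (hA.sub (integrable_const _))).1 h0]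
    with s hs
  exact sub_eq_zero.1 hs

variable {X : Type*} [MeasurableSpace X] {μ : Measure X} {Ω : Set X} {u v f : X → ℝ}

theorem chi_setOf_lt_eq_one_sub (u : X → ℝ) {s : ℝ} (h : μ.restrict Ω {x | u x = s} = 0) :
    (fun x => 1 - chi {y | s < u y} x) =ᵐ[μ.restrict Ω] chi {y | u y < s} := by
  have h' : ∀ᵐ x ∂(μ.restrict Ω), u x ≠ s := by
    rw [ae_iff]
    simpa using h
  filter_upwards [h'] with x hx
  rcases lt_or_gt_of_ne hx with hlt | hlt
  · rw [chi, chi, indicator_of_mem (show x ∈ {y | u y < s} from hlt),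
      indicator_of_notMem (show x ∉ {y | s < u y} from not_lt.2 hlt.le), sub_zero]
  · rw [chi, chi, indicator_of_notMem (show x ∉ {y | u y < s} from not_lt.2 hlt.le),
      indicator_of_mem (show x ∈ {y | s < u y} from hlt), sub_self]

/-- The difference of the characteristic functions of `{u > t₁}` and `{u < -t₂}` in `Ω`. -/
noncomputable def levelDiff {X : Type*} (Ω : Set X) (u : X → ℝ) (t₁ t₂ : ℝ) (x : X) : ℝ :=
  chi {y ∈ Ω | t₁ < u y} x - chi {y ∈ Ω | u y < -t₂} x

theorem levelDiff_congr_ae (h : u =ᵐ[μ.restrict Ω] v) (t₁ t₂ : ℝ) :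
    levelDiff Ω u t₁ t₂ =ᵐ[μ.restrict Ω] levelDiff Ω v t₁ t₂ := by
  filter_upwards [h] with x hx
  have h1 : x ∈ {y ∈ Ω | t₁ < u y} ↔ x ∈ {y ∈ Ω | t₁ < v y} := by simp [hx]
  have h2 : x ∈ {y ∈ Ω | u y < -t₂} ↔ x ∈ {y ∈ Ω | v y < -t₂} := by simp [hx]
  classical
  simp only [levelDiff, chi, indicator_apply, h1, h2]

theorem levelDiff_ae_eq (hΩ : MeasurableSet Ω) (u : X → ℝ) (t₁ t₂ : ℝ) :
    (fun x => chi {y | t₁ < u y} x - chi {y | u y < -t₂} x) =ᵐ[μ.restrict Ω]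
      levelDiff Ω u t₁ t₂ := by
  filter_upwards [ae_restrict_mem hΩ] with x hx
  have h1 : x ∈ {y ∈ Ω | t₁ < u y} ↔ x ∈ {y | t₁ < u y} := by simp [hx]
  have h2 : x ∈ {y ∈ Ω | u y < -t₂} ↔ x ∈ {y | u y < -t₂} := by simp [hx]
  classical
  simp only [levelDiff, chi, indicator_apply, h1, h2]

theorem abs_chi_sub_chi_le_one {X : Type*} (E F : Set X) (x : X) : |chi E x - chi F x| ≤ 1 := by
  rw [abs_le]
  constructor <;> linarith [chi_nonneg E x, chi_le_one E x, chi_nonneg F x, chi_le_one F x]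

variable [MetricSpace X]

theorem BV.congr_ae (hu : BV μ u Ω) (h : u =ᵐ[μ.restrict Ω] v) : BV μ v Ω :=
  ⟨hu.1.congr h, totalVariation_congr_ae h ▸ hu.2⟩

theorem Admissible.congr_ae (hu : Admissible μ Ω u) (h : u =ᵐ[μ.restrict Ω] v) :
    Admissible μ Ω v :=
  ⟨hu.1.congr_ae h, by
    filter_upwards [hu.2, h] with x hx hx'
    rwa [← hx']⟩

theorem bv_of_abs_le_one (hμΩ : μ Ω ≠ ∞) (hum : Measurable u) (hub : ∀ x, |u x| ≤ 1)
    (hTV : totalVariation μ u Ω < ∞) : BV μ u Ω := by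
  have : IsFiniteMeasure (μ.restrict Ω) := isFiniteMeasure_restrict.2 hμΩ
  exact ⟨Integrable.of_bound hum.aestronglyMeasurable 1 (Eventually.of_forall hub), hTV⟩

variable [BorelSpace X]

theorem functionalI_congr_ae (h : u =ᵐ[μ.restrict Ω] v) :
    functionalI μ Ω f u = functionalI μ Ω f v := by
  rw [functionalI, functionalI, totalVariation_congr_ae h, trace_congr_ae h]

theorem integral_trace_sub_mul [SecondCountableTopology X] [SFinite μ] {ρ : Measure X}
    (hμ : IsDoubling μ) (hΩ : MeasurableSet Ω)
    (hρ : ∀ᵐ x ∂ρ, ∀ r : ℝ, 0 < r → 0 < μ (Metric.ball x r ∩ Ω)) (hf : Integrable f ρ)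
    (hum : Measurable u) (hub : ∀ y, |u y| ≤ 1) (hu : ∀ᵐ x ∂ρ, ∃ τ, IsTrace μ Ω u x τ)
    (hvm : Measurable v) (hvb : ∀ y, |v y| ≤ 1) (hv : ∀ᵐ x ∂ρ, ∃ τ, IsTrace μ Ω v x τ)
    (huv : ∀ y, |u y - v y| ≤ 1) :
    ∫ x, trace μ Ω (fun y => u y - v y) x * f x ∂ρ =
      ∫ x, trace μ Ω u x * f x ∂ρ - ∫ x, trace μ Ω v x * f x ∂ρ := by
  rw [← integral_sub (integrable_trace_mul hμ hΩ hρ hf hum hub hu)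
    (integrable_trace_mul hμ hΩ hρ hf hvm hvb hv)]
  have hm : Measurable fun y => u y - v y := hum.sub hvm
  refine integral_congr_ae ?_
  filter_upwards [hρ, hu, hv] with x hx hux hvx
  rw [((isTrace_trace hux).sub (isTrace_trace hvx) hum).trace_eq hμ hx hm huv, sub_mul]

/-- Absolute continuity turns existence of traces `ℋ`-almost everywhere into existence almost
everywhere for the perimeter measure. -/
theorem ae_exists_isTrace [ProperSpace X] [Nonempty X] [SFinite μ] (hμ : IsDoubling μ)
    (hΩ : IsOpen Ω) (hper : totalVariation μ (chi Ω) univ < ∞) (htr : HasTraces μ Ω)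
    (hu : BV μ u Ω) :
    ∀ᵐ x ∂((perimeterMeasure μ Ω).restrict (measureBoundary μ Ω)), ∃ τ, IsTrace μ Ω u x τ := by
  rw [ae_restrict_iff' (hμ.measurableSet_measureBoundary Ω), ae_iff]
  simp only [Classical.not_imp]
  exact hμ.perimeterMeasure_eq_zero hper (measurable_const.indicator hΩ.measurableSet) (htr u hu)

/-- The functional of `u` dominates the average over the levels of functions `A` and `B`, which in
turn dominate the functional of the differences of characteristic functions of level sets. -/
theorem exists_level_majorants [ProperSpace X] [Nonempty X] (hμ : IsDoubling μ) (hΩ : IsOpen Ω)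
    (hΩb : Bornology.IsBounded Ω) (hper : totalVariation μ (chi Ω) univ < ∞)
    (htr : HasTraces μ Ω) (hf : IntegrableOn f (measureBoundary μ Ω) (perimeterMeasure μ Ω))
    (hu : BV μ u Ω) (hum : Measurable u) (hub : ∀ x, |u x| ≤ 1) :
    ∃ A B : ℝ → ℝ, IntegrableOn A (Ioo 0 1) ∧ IntegrableOn B (Ioo 0 1) ∧
      (∫ t in Ioo (0 : ℝ) 1, A t) + ∫ t in Ioo (0 : ℝ) 1, B t ≤ functionalI μ Ω f u ∧
      ∃ N : Set ℝ, volume N = 0 ∧ ∀ t₁ ∈ Ioo (0 : ℝ) 1 \ N, ∀ t₂ ∈ Ioo (0 : ℝ) 1 \ N,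
        Admissible μ Ω (levelDiff Ω u t₁ t₂) ∧
        functionalI μ Ω f (levelDiff Ω u t₁ t₂) ≤ A t₁ + B t₂ := by
  have := hμ.isLocallyFiniteMeasure
  have := isFiniteMeasure_perimeterMeasure hper
  have hΩm := hΩ.measurableSet
  have hμΩ : μ Ω ≠ ∞ := (hμ.measure_lt_top hΩb).ne
  set ρ := (perimeterMeasure μ Ω).restrict (measureBoundary μ Ω) with hρdef
  have hρ : ∀ᵐ x ∂ρ, ∀ r : ℝ, 0 < r → 0 < μ (Metric.ball x r ∩ Ω) :=
    (ae_restrict_mem (hμ.measurableSet_measureBoundary Ω)).mono fun x hx r hr =>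
      measure_ball_inter_pos_of_mem_measureBoundary hx hr
  have hf' : Integrable f ρ := hf
  obtain ⟨G, hGm, hGi, hG⟩ := exists_coarea_majorant hΩ hum hu.2
  have hGfin : ∀ᵐ t, G t < ∞ := ae_lt_top hGm (hGi.trans_lt hu.2).ne
  -- almost every level is good
  have hneg : ∀ {P : ℝ → Prop}, (∀ᵐ t, P t) → ∀ᵐ t, P (-t) := fun h =>
    (Measure.measurePreserving_neg (volume : Measure ℝ)).quasiMeasurePreserving.ae h
  -- All but countably many levels have this property. At these, `{u < s}` is the complement of `{u
  -- > s}` in `Ω` up to a null set.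
  have hlev : ∀ᵐ s, μ.restrict Ω {x | u x = s} = 0 := by
    have hc := Measure.countable_meas_level_set_pos (μ := μ.restrict Ω) hum
    filter_upwards [hc.ae_notMem volume] with s hs
    simpa using hs
  have hup : ∀ᵐ t, BV μ (chi {y | t < u y}) Ω ∧
      totalVariation μ (chi {y | t < u y}) Ω ≤ G t ∧ G t < ∞ := by
    filter_upwards [hG, hGfin] with t h1 h2
    exact ⟨bv_of_abs_le_one hμΩ (measurable_chi_setOf_lt_const hum t) (abs_chi_le_one _)
      (h1.trans_lt h2), h1, h2⟩
  have hlowm : ∀ s, Measurable (chi {y | u y < s}) := fun s =>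
    measurable_const.indicator (measurableSet_lt hum measurable_const)
  have hlow : ∀ᵐ t, BV μ (chi {y | u y < -t}) Ω ∧
      totalVariation μ (chi {y | u y < -t}) Ω ≤ G (-t) ∧ G (-t) < ∞ := by
    filter_upwards [hneg hup, hneg hlev] with t h1 h2
    have h3 : totalVariation μ (chi {y | u y < -t}) Ω ≤ G (-t) := by
      rw [← totalVariation_congr_ae (chi_setOf_lt_eq_one_sub u h2)]
      exact totalVariation_one_sub_le.trans h1.2.1
    exact ⟨bv_of_abs_le_one hμΩ (hlowm _) (abs_chi_le_one _) (h3.trans_lt h1.2.2), h3, h1.2.2⟩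
  have htrace : ∀ {v : X → ℝ}, BV μ v Ω → ∀ᵐ x ∂ρ, ∃ τ, IsTrace μ Ω v x τ := fun hv =>
    ae_exists_isTrace hμ hΩ hper htr hv
  -- the positive and the negative part
  have hpos_sets : ∀ t : ℝ, 0 < t → {y | t < max (u y) 0} = {y | t < u y} := fun t ht => by
    ext y
    simp [ht.not_gt]
  have hneg_sets : ∀ t : ℝ, 0 < t → {y | t < max (-u y) 0} = {y | u y < -t} := fun t ht => by
    ext y
    simp [ht.not_gt, lt_neg]
  have hab := fun y => abs_le.1 (hub y)
  -- The positive part is a 1-Lipschitz function of `u`, so it inherits a trace from `u`.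
  have htp : ∀ᵐ x ∂ρ, ∃ τ, IsTrace μ Ω (fun y => max (u y) 0) x τ := by
    filter_upwards [htrace hu] with x ⟨τ, hτ⟩
    exact ⟨max τ 0, hτ.of_abs_sub_le fun y => abs_max_sub_max_le_abs _ _ _⟩
  have htn : ∀ᵐ x ∂ρ, ∃ τ, IsTrace μ Ω (fun y => max (-u y) 0) x τ := by
    filter_upwards [htrace hu] with x ⟨τ, hτ⟩
    refine ⟨max (-τ) 0, hτ.of_abs_sub_le fun y => (abs_max_sub_max_le_abs _ _ _).trans ?_⟩
    rw [neg_sub_neg, abs_sub_comm]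
  have hmp : Measurable fun y => max (u y) 0 := hum.max measurable_const
  have hmn : Measurable fun y => max (-u y) 0 := hum.neg.max measurable_const
  have hbp : ∀ y, max (u y) 0 ≤ 1 := fun y => max_le (hab y).2 zero_le_one
  have hbn : ∀ y, max (-u y) 0 ≤ 1 := fun y => max_le (neg_le.1 (hab y).1) zero_le_one
  obtain ⟨hc1i, hc1⟩ := integral_trace_mul_eq hμ hΩm hρ hf' hmp
    (fun y => le_max_right _ _) hbp htp (by
      filter_upwards [ae_restrict_mem measurableSet_Ioo, ae_restrict_of_ae hup] with t ht h
      rw [hpos_sets t ht.1]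
      exact htrace h.1)
  obtain ⟨hc2i, hc2⟩ := integral_trace_mul_eq hμ hΩm hρ hf' hmn
    (fun y => le_max_right _ _) hbn htn (by
      filter_upwards [ae_restrict_mem measurableSet_Ioo, ae_restrict_of_ae hlow] with t ht h
      rw [hneg_sets t ht.1]
      exact htrace h.1)
  have hsplit := integral_trace_sub_mul hμ hΩm hρ hf' hmp
    (fun y => by rw [abs_of_nonneg (le_max_right _ _)]; exact hbp y) htp hmn
    (fun y => by rw [abs_of_nonneg (le_max_right _ _)]; exact hbn y) htn
    (fun y => by rw [max_zero_sub_max_neg_zero_eq_self]; exact hub y)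
  have hself : (fun y => max (u y) 0 - max (-u y) 0) = u := by
    ext y
    rw [max_zero_sub_max_neg_zero_eq_self]
  rw [hself, ← hc1, ← hc2] at hsplit
  -- the variation part
  have hG1 : IntegrableOn (fun t => (G t).toReal) (Ioo 0 1) :=
    (integrable_toReal_of_lintegral_ne_top hGm.aemeasurable (hGi.trans_lt hu.2).ne).integrableOn
  have hGneg : ∫⁻ t, G (-t) = ∫⁻ t, G t := lintegral_neg_eq_self G
  have hGnm : Measurable fun t => G (-t) := hGm.comp measurable_neg
  have hG2 : IntegrableOn (fun t => (G (-t)).toReal) (Ioo 0 1) :=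
    (integrable_toReal_of_lintegral_ne_top hGnm.aemeasurable
      (by rw [hGneg]; exact (hGi.trans_lt hu.2).ne)).integrableOn
  -- The layers of `u⁺` use the levels in `(0, 1)` and those of `u⁻` the levels in `(-1, 0)`. These
  -- are disjoint, so the two integrals together are at most `∫ G`.
  have hGle : (∫ t in Ioo (0 : ℝ) 1, (G t).toReal) + ∫ t in Ioo (0 : ℝ) 1, (G (-t)).toReal ≤
      (totalVariation μ u Ω).toReal := by
    have hle1 : ∫⁻ t in Ioo (0 : ℝ) 1, G t ≤ totalVariation μ u Ω :=
      (setLIntegral_le_lintegral _ _).trans hGi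
    have hle2 : ∫⁻ t in Ioo (0 : ℝ) 1, G (-t) ≤ totalVariation μ u Ω :=
      (setLIntegral_le_lintegral _ _).trans (hGneg.trans_le hGi)
    rw [integral_toReal hGm.aemeasurable (ae_restrict_of_ae hGfin),
      integral_toReal hGnm.aemeasurable (ae_restrict_of_ae (hneg hGfin)),
      ← ENNReal.toReal_add (hle1.trans_lt hu.2).ne (hle2.trans_lt hu.2).ne]
    refine ENNReal.toReal_mono hu.2.ne (le_trans ?_ hGi)
    have hpre : Ioo (0 : ℝ) 1 = Neg.neg ⁻¹' Ioo (-1) 0 := by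
      ext t
      simp
    have h2 : ∫⁻ t in Ioo (0 : ℝ) 1, G (-t) = ∫⁻ t in Ioo (-1 : ℝ) 0, G t := by
      rw [hpre]
      exact (Measure.measurePreserving_neg volume).setLIntegral_comp_preimage_emb
        (MeasurableEquiv.neg ℝ).measurableEmbedding G _
    rw [h2, ← lintegral_union measurableSet_Ioo
      (Set.disjoint_left.2 fun t h h' => absurd h.1 (not_lt.2 h'.2.le))]
    exact setLIntegral_le_lintegral _ _
  refine ⟨fun t => (G t).toReal + ∫ x, trace μ Ω (chi {y | t < max (u y) 0}) x * f x ∂ρ,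
    fun t => (G (-t)).toReal - ∫ x, trace μ Ω (chi {y | t < max (-u y) 0}) x * f x ∂ρ,
    hG1.add hc1i, hG2.sub hc2i, ?_, ?_⟩
  · rw [integral_add hG1 hc1i, integral_sub hG2 hc2i, functionalI, hsplit]
    linarith
  · refine ⟨_, ae_iff.1 (hup.and hlow), fun t₁ ht₁ t₂ ht₂ => ?_⟩
    obtain ⟨⟨hbv1, hle1, hfin1⟩, -⟩ := not_not.1 ht₁.2
    obtain ⟨-, hbv2, hle2, hfin2⟩ := not_not.1 ht₂.2
    have hm1 := measurable_chi_setOf_lt_const hum t₁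
    have hm2 := hlowm (-t₂)
    have hTV := totalVariation_sub_le hΩ hm1.aemeasurable (μ := μ) (v := chi {y | u y < -t₂})
    have hTV' := hTV.trans (add_le_add hle1 hle2)
    have hGG : G t₁ + G (-t₂) < ∞ := ENNReal.add_lt_top.2 ⟨hfin1, hfin2⟩
    have hae := levelDiff_ae_eq (μ := μ) hΩm u t₁ t₂
    refine ⟨Admissible.congr_ae ⟨bv_of_abs_le_one hμΩ (hm1.sub hm2) (abs_chi_sub_chi_le_one _ _)
      (hTV'.trans_lt hGG), Eventually.of_forall fun x => abs_le.1 (abs_chi_sub_chi_le_one _ _ x)⟩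
      hae, ?_⟩
    beta_reduce
    rw [← functionalI_congr_ae hae, functionalI, integral_trace_sub_mul hμ hΩm hρ hf' hm1
      (abs_chi_le_one _) (htrace hbv1) hm2 (abs_chi_le_one _) (htrace hbv2)
      (abs_chi_sub_chi_le_one _ _), hpos_sets t₁ ht₁.1.1, hneg_sets t₂ ht₂.1.1]
    have h3 := ENNReal.toReal_mono hGG.ne hTV'
    rw [ENNReal.toReal_add hfin1.ne hfin2.ne] at h3
    linarith

theorem IsSolution.congr_ae (hu : IsSolution μ Ω f u) (h : u =ᵐ[μ.restrict Ω] v) :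
    IsSolution μ Ω f v :=
  ⟨hu.1.congr_ae h, fun w hw => functionalI_congr_ae (f := f) h ▸ hu.2 w hw⟩

end

end MetricBV

/-! ### The proposition: choice of levels, and the case of equality for solutions. -/

open MetricBV in
theorem mainTheorem6 {X : Type*} [MetricSpace X] [CompleteSpace X] [Nontrivial X]
    [MeasurableSpace X] [BorelSpace X] (μ : Measure X)
    (hμ : MetricBV.IsDoubling μ) (hP : MetricBV.SupportsPoincare μ)
    (Ω : Set X) (hΩ_open : IsOpen Ω) (hΩ_ne : Ω.Nonempty) (hΩ_bdd : Bornology.IsBounded Ω)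
    (hΩ_per : MetricBV.totalVariation μ (MetricBV.chi Ω) univ < ∞)
    (hΩ_trace : MetricBV.HasTraces μ Ω)
    (f : X → ℝ)
    (hf : IntegrableOn f (MetricBV.measureBoundary μ Ω) (MetricBV.perimeterMeasure μ Ω))
    (hf_zero : ∫ x in MetricBV.measureBoundary μ Ω, f x ∂(MetricBV.perimeterMeasure μ Ω) = 0)
    (u : X → ℝ) (hu : MetricBV.BV μ u Ω)
    (hu_bd : ∀ᵐ x ∂(μ.restrict Ω), -1 ≤ u x ∧ u x ≤ 1) :
    (∃ E₁ E₂ : Set X, E₁ ⊆ Ω ∧ E₂ ⊆ Ω ∧ Disjoint E₁ E₂ ∧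
      NullMeasurableSet E₁ μ ∧ NullMeasurableSet E₂ μ ∧
      MetricBV.BV μ (fun x => MetricBV.chi E₁ x - MetricBV.chi E₂ x) Ω ∧
      MetricBV.functionalI μ Ω f (fun x => MetricBV.chi E₁ x - MetricBV.chi E₂ x) ≤
        MetricBV.functionalI μ Ω f u) ∧
    (MetricBV.IsSolution μ Ω f u →
      ∃ N : Set ℝ, volume N = 0 ∧ ∀ t₁ ∈ Ioo (0 : ℝ) 1 \ N, ∀ t₂ ∈ Ioo (0 : ℝ) 1 \ N,
        MetricBV.IsSolution μ Ω f (fun x =>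
          MetricBV.chi {y ∈ Ω | t₁ < u y} x - MetricBV.chi {y ∈ Ω | u y < -t₂} x)) := by
  have := hμ.properSpace
  have hΩm := hΩ_open.measurableSet
  obtain ⟨v, hvm, hvb, huv⟩ : ∃ v : X → ℝ, Measurable v ∧ (∀ x, |v x| ≤ 1) ∧
      u =ᵐ[μ.restrict Ω] v := by
    -- A Borel representative of `u` in `Ω`, truncated so that its bound holds everywhere; the
    -- functional does not see the change.
    refine ⟨fun x => max (-1) (min 1 (hu.1.aestronglyMeasurable.mk u x)), ?_, fun x => ?_, ?_⟩
    · exact measurable_const.max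
        (measurable_const.min hu.1.aestronglyMeasurable.stronglyMeasurable_mk.measurable)
    · exact abs_le.2 ⟨le_max_left _ _, max_le (by norm_num) (min_le_left _ _)⟩
    · filter_upwards [hu.1.aestronglyMeasurable.ae_eq_mk, hu_bd] with x hx hb
      rw [← hx, min_eq_right hb.2, max_eq_right hb.1]
  obtain ⟨A, B, hA, hB, hAB, N, hN, hlev⟩ := exists_level_majorants hμ hΩ_open hΩ_bdd hΩ_per
    hΩ_trace hf (hu.congr_ae huv) hvm hvb
  rw [← functionalI_congr_ae huv] at hAB
  have hprob : IsProbabilityMeasure (volume.restrict (Ioo (0 : ℝ) 1)) := ⟨by simp⟩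
  constructor
  -- The complement of `(0, 1)` is added to the null set so that the levels chosen below lie in `(0,
  -- 1)`.
  · have hN' : volume.restrict (Ioo (0 : ℝ) 1) (N ∪ (Ioo 0 1)ᶜ) = 0 :=
      measure_union_null (Measure.absolutelyContinuous_of_le Measure.restrict_le_self hN)
        (by rw [Measure.restrict_apply measurableSet_Ioo.compl]; simp)
    obtain ⟨t₁, ht₁, hAt⟩ := exists_notMem_null_le_integral hA hN'
    obtain ⟨t₂, ht₂, hBt⟩ := exists_notMem_null_le_integral hB hN'
    rw [mem_union, not_or, mem_compl_iff, not_not] at ht₁ ht₂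
    obtain ⟨hadm, hle⟩ := hlev t₁ ⟨ht₁.2, ht₁.1⟩ t₂ ⟨ht₂.2, ht₂.1⟩
    refine ⟨{y ∈ Ω | t₁ < v y}, {y ∈ Ω | v y < -t₂}, fun y hy => hy.1, fun y hy => hy.1,
      Set.disjoint_left.2 fun y hy hy' => ?_,
      (hΩm.inter (measurableSet_lt measurable_const hvm)).nullMeasurableSet,
      (hΩm.inter (measurableSet_lt hvm measurable_const)).nullMeasurableSet, hadm.1,
      hle.trans ((add_le_add hAt hBt).trans hAB)⟩
    have h1 : t₁ < v y := hy.2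
    have h2 : v y < -t₂ := hy'.2
    linarith [ht₁.2.1, ht₂.2.1]
  · intro hsol
    have hNae : ∀ᵐ t ∂(volume.restrict (Ioo (0 : ℝ) 1)), t ∈ Ioo (0 : ℝ) 1 \ N := by
      filter_upwards [ae_restrict_mem measurableSet_Ioo,
        ae_restrict_of_ae (measure_eq_zero_iff_ae_notMem.1 hN)] with t h1 h2
      exact ⟨h1, h2⟩
    have hlow : ∀ s ∈ Ioo (0 : ℝ) 1 \ N, ∀ t ∈ Ioo (0 : ℝ) 1 \ N,
        functionalI μ Ω f u ≤ A s + B t := fun s hs t ht =>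
      (hsol.2 _ (hlev s hs t ht).1).trans (hlev s hs t ht).2
    -- For a solution `I(u)` lies below `A s + B t` at almost all levels and above the sum of the
    -- means, so both functions are constant almost everywhere.
    have hAe := ae_eq_integral_of_le_add hA hB hAB (by
      filter_upwards [hNae] with s hs
      filter_upwards [hNae] with t ht
      exact hlow s hs t ht)
    have hBe := ae_eq_integral_of_le_add hB hA ((add_comm _ _).trans_le hAB) (by
      filter_upwards [hNae] with s hs
      filter_upwards [hNae] with t ht
      exact (hlow t ht s hs).trans_eq (add_comm _ _))
    rw [ae_restrict_iff' measurableSet_Ioo] at hAe hBe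
    refine ⟨_, ae_iff.1 ((hAe.and hBe).and (measure_eq_zero_iff_ae_notMem.1 hN)),
      fun t₁ ht₁ t₂ ht₂ => ?_⟩
    obtain ⟨⟨h1, -⟩, h1N⟩ := not_not.1 ht₁.2
    obtain ⟨⟨-, h2⟩, h2N⟩ := not_not.1 ht₂.2
    obtain ⟨hadm, hle⟩ := hlev t₁ ⟨ht₁.1, h1N⟩ t₂ ⟨ht₂.1, h2N⟩
    rw [h1 ht₁.1, h2 ht₂.1] at hle
    -- At these levels the bound `A t₁ + B t₂` is the sum of the means, hence at most the minimal
    -- value `I(u)`. The result for the representative `v` is then carried back to the level sets of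
    -- `u`.
    exact IsSolution.congr_ae ⟨hadm, fun w hw => (hle.trans hAB).trans (hsol.2 w hw)⟩
      (levelDiff_congr_ae huv.symm t₁ t₂)
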